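/- Let $n\ge 1$, let $\Omega\subset\mathbb R^n$ be a bounded open set, let $\varepsilon>0$, put $\Gamma_\varepsilon=\{x\in\mathbb R^n\setminus\Omega:\operatorname{dist}(x,\partial\Omega)<\varepsilon\}$, and let $F:\Gamma_\varepsilon\to\mathbb R$ be continuous and bounded. The $\Omega$-game is the following two-player zero-sum game. A token starts at $x_0\in\Omega\cup\Gamma_\varepsilon$, and the game ends at the first time $\tau$ with $x_\tau\in\Gamma_\varepsilon$. A strategy $S_{\mathrm I}$ of Player I, and likewise $S_{\mathrm{II}}$ of Player II, is an arbitrary function that assigns to every partial history $(x_0,\dots,x_k)$ a point of the closed ball $\overline B_\varepsilon(x_k)$. Player II also chooses a decision rule $\theta$, an arbitrary function of the partial histories with values in $\{0,1\}$ and with $\theta(x_0,\dots,x_k)=0$ unless $x_k\in\Omega$. If $\theta(x_0,\dots,x_k)=1$, then Player II sells the turn at price $\varepsilon$ and $x_{k+1}=S_{\mathrm I}(x_0,\dots,x_k)$. If $\theta(x_0,\dots,x_k)=0$, then a fair coin, independent of the past, is tossed and $x_{k+1}$ is $S_{\mathrm I}(x_0,\dots,x_k)$ or $S_{\mathrm{II}}(x_0,\dots,x_k)$,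 each with probability $\tfrac12$. The payoff to Player I is $F(x_\tau)-\varepsilon\sum_{i=0}^{\tau-1}\theta(x_0,\dots,x_i)$, and $\mathbb E^{x_0}_{S_{\mathrm I},S_{\mathrm{II}},\theta}$ denotes the expectation for the resulting law of the game. Define the values of Player I and Player II, as extended real numbers, by $$u^\varepsilon_{\mathrm I}(x_0)=\sup_{S_{\mathrm I}}\inf_{S_{\mathrm{II}},\theta}\mathbb E^{x_0}_{S_{\mathrm I},S_{\mathrm{II}},\theta}\Big[F(x_\tau)-\varepsilon\sum_{i=0}^{\tau-1}\theta(x_0,\dots,x_i)\Big],\qquad u^\varepsilon_{\mathrm{II}}(x_0)=\inf_{S_{\mathrm{II}},\theta}\sup_{S_{\mathrm I}}\mathbb E^{x_0}_{S_{\mathrm I},S_{\mathrm{II}},\theta}\Big[F(x_\tau)-\varepsilon\sum_{i=0}^{\tau-1}\theta(x_0,\dots,x_i)\Big],$$ where, if the game does not end almost surely, the expectation is replaced by $-\infty$ in the definition of $u^\varepsilon_{\mathrm I}$ and by $+\infty$ in the definition of $u^\varepsilon_{\mathrm{II}}$. Then the $\Omega$-game has a value: $u^\varepsilon_{\mathrm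 I}(x)=u^\varepsilon_{\mathrm{II}}(x)$ for every $x\in\Omega\cup\Gamma_\varepsilon$. -/

import Mathlib

open MeasureTheory

namespace TugOfWar

/-- The boundary strip `Γ_ε = {x ∉ Ω : dist(x, ∂Ω) < ε}`. -/
def boundaryStrip {n : ℕ} (Ω : Set (EuclideanSpace ℝ (Fin n))) (ε : ℝ) :
    Set (EuclideanSpace ℝ (Fin n)) :=
  {x | x ∉ Ω ∧ Metric.infDist x (frontier Ω) < ε}

/-- A strategy: it assigns to every partial history `(x₀, …, x_k)` a next position in the closed
ball of radius `ε` around `x_k`. No measurability is required. -/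
structure Strategy (n : ℕ) (ε : ℝ) where
  move : (k : ℕ) → (Fin (k + 1) → EuclideanSpace ℝ (Fin n)) → EuclideanSpace ℝ (Fin n)
  move_mem : ∀ k h, move k h ∈ Metric.closedBall (h (Fin.last k)) ε

/-- A decision rule `θ` of Player II: after every partial history `(x₀, …, x_k)` it says whether
Player II sells the turn, which is only possible when `x_k ∈ D`. -/
structure SellingRule {n : ℕ} (D : Set (EuclideanSpace ℝ (Fin n))) where
  sell : (k : ℕ) → (Fin (k + 1) → EuclideanSpace ℝ (Fin n)) → Bool
  sell_mem : ∀ k h, sell k h = true → h (Fin.last k) ∈ D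

/-- The law of an infinite sequence of independent fair coin tosses; `true` means that
Player I wins the toss. -/
noncomputable def coinMeasure : Measure (ℕ → Bool) :=
  Measure.infinitePi fun _ => (PMF.uniformOfFintype Bool).toMeasure

/-- The next position after the partial history `h`, when the result of the toss is `c`: Player I
moves if the turn is sold or if she wins the toss, otherwise Player II moves. (If the turn is sold
the toss has no effect.) -/
def nextPosition {n : ℕ} {D : Set (EuclideanSpace ℝ (Fin n))} {ε : ℝ}
    (S₁ S₂ : Strategy n ε) (θ : SellingRule D) (k : ℕ)
    (h : Fin (k + 1) → EuclideanSpace ℝ (Fin n)) (c : Bool) : EuclideanSpace ℝ (Fin n) :=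
  if θ.sell k h = true then S₁.move k h
  else if c = true then S₁.move k h else S₂.move k h

/-- The partial history `(x₀, …, x_k)` produced by the strategies `S₁`, `(S₂, θ)` from the starting
point `x₀`, when the results of the tosses are `ω`. -/
def history {n : ℕ} {D : Set (EuclideanSpace ℝ (Fin n))} {ε : ℝ}
    (S₁ S₂ : Strategy n ε) (θ : SellingRule D) (x₀ : EuclideanSpace ℝ (Fin n)) (ω : ℕ → Bool) :
    (k : ℕ) → Fin (k + 1) → EuclideanSpace ℝ (Fin n)
  | 0 => fun _ => x₀
  | k + 1 =>
    Fin.snoc (α := fun _ => EuclideanSpace ℝ (Fin n)) (history S₁ S₂ θ x₀ ω k)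
      (nextPosition S₁ S₂ θ k (history S₁ S₂ θ x₀ ω k) (ω k))

/-- The position `x_k` of the game token. -/
def position {n : ℕ} {D : Set (EuclideanSpace ℝ (Fin n))} {ε : ℝ}
    (S₁ S₂ : Strategy n ε) (θ : SellingRule D) (x₀ : EuclideanSpace ℝ (Fin n)) (ω : ℕ → Bool)
    (k : ℕ) : EuclideanSpace ℝ (Fin n) :=
  history S₁ S₂ θ x₀ ω k (Fin.last k)

/-- The history up to time `k` depends only on the tosses before time `k`. -/
theorem history_congr {n : ℕ} {D : Set (EuclideanSpace ℝ (Fin n))} {ε : ℝ}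
    (S₁ S₂ : Strategy n ε) (θ : SellingRule D) (x₀ : EuclideanSpace ℝ (Fin n))
    {ω ω' : ℕ → Bool} (k : ℕ) (hω : ∀ i < k, ω i = ω' i) :
    history S₁ S₂ θ x₀ ω k = history S₁ S₂ θ x₀ ω' k := by
  induction k with
  | zero => rfl
  | succ k ih =>
    simp only [history]
    rw [ih (fun i hi => hω i (by omega)), hω k (by omega)]

/-- An event that depends only on the tosses before time `k` is independent of toss `k`. -/
theorem coin_indep (k : ℕ) (A : Set (ℕ → Bool)) (B : Set Bool)
    (hA : ∀ ω ω', (∀ i < k, ω i = ω' i) → (ω ∈ A ↔ ω' ∈ A)) :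
    coinMeasure (A ∩ {ω | ω k ∈ B}) =
      coinMeasure A * (PMF.uniformOfFintype Bool).toMeasure B := by
  have h1 : ProbabilityTheory.iIndepFun (fun (i : ℕ) (ω : ℕ → Bool) => ω i) coinMeasure :=
    ProbabilityTheory.iIndepFun_infinitePi (P := fun _ : ℕ => (PMF.uniformOfFintype Bool).toMeasure)
      (X := fun _ b => b) (fun _ => measurable_id)
  have h2 := h1.indepFun_finset (Finset.range k) {k} (by simp) (fun i => measurable_pi_apply i)
  have h3 := h2.measure_inter_preimage_eq_mul
    ((fun ω (i : Finset.range k) => ω i.1) '' A) ((fun f => f ⟨k, by simp⟩) ⁻¹' B)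
    (Set.toFinite _).measurableSet (Set.toFinite _).measurableSet
  have e1 : (fun (ω : ℕ → Bool) (i : Finset.range k) => ω i.1) ⁻¹'
      ((fun ω (i : Finset.range k) => ω i.1) '' A) = A := by
    ext ω
    constructor
    · rintro ⟨ω', hω', h⟩
      exact (hA ω' ω fun i hi => congrFun h ⟨i, by simpa using hi⟩).1 hω'
    · exact fun h => ⟨ω, h, rfl⟩
  have e2 : coinMeasure {ω | ω k ∈ B} = (PMF.uniformOfFintype Bool).toMeasure B :=
    (measurePreserving_eval_infinitePi
      (fun _ : ℕ => (PMF.uniformOfFintype Bool).toMeasure) k).measure_preimage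
      (Set.toFinite _).measurableSet.nullMeasurableSet
  rw [e1] at h3
  rw [← e2]
  exact h3

/-- The one-step transition probabilities
`(1 - θ(h)) * (1/2) * (δ_{S_I(h)} + δ_{S_II(h)}) + θ(h) * δ_{S_I(h)}` after the history `h`. -/
noncomputable def transition {n : ℕ} {D : Set (EuclideanSpace ℝ (Fin n))} {ε : ℝ}
    (S₁ S₂ : Strategy n ε) (θ : SellingRule D) (k : ℕ)
    (h : Fin (k + 1) → EuclideanSpace ℝ (Fin n)) : Measure (EuclideanSpace ℝ (Fin n)) :=
  (1 - if θ.sell k h = true then (1 : ENNReal) else 0) • (1 / 2 : ENNReal) •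
      (Measure.dirac (S₁.move k h) + Measure.dirac (S₂.move k h)) +
    (if θ.sell k h = true then (1 : ENNReal) else 0) • Measure.dirac (S₁.move k h)

/-- Under the law of the tosses, the sequence of game positions starts from `x₀` and has the
one-step transition probabilities `transition`. (Each partial history takes only finitely many
values, so this determines the law of the sequence of positions.) -/
theorem history_transition {n : ℕ} {D : Set (EuclideanSpace ℝ (Fin n))} {ε : ℝ}
    (S₁ S₂ : Strategy n ε) (θ : SellingRule D) (x₀ : EuclideanSpace ℝ (Fin n)) (k : ℕ)
    (h : Fin (k + 1) → EuclideanSpace ℝ (Fin n)) (A : Set (EuclideanSpace ℝ (Fin n)))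
    (hA : MeasurableSet A) :
    coinMeasure {ω | history S₁ S₂ θ x₀ ω k = h ∧ position S₁ S₂ θ x₀ ω (k + 1) ∈ A} =
      coinMeasure {ω | history S₁ S₂ θ x₀ ω k = h} * transition S₁ S₂ θ k h A := by
  have e : {ω | history S₁ S₂ θ x₀ ω k = h ∧ position S₁ S₂ θ x₀ ω (k + 1) ∈ A} =
      {ω | history S₁ S₂ θ x₀ ω k = h} ∩ {ω | ω k ∈ {c | nextPosition S₁ S₂ θ k h c ∈ A}} := by
    ext ω
    simp only [Set.mem_ofPred_eq, Set.mem_inter_iff, position, history, Fin.snoc_last]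
    constructor <;> (rintro ⟨rfl, h2⟩; exact ⟨rfl, h2⟩)
  rw [e, coin_indep k _ _ (fun ω ω' hω => by
    simp only [Set.mem_ofPred_eq, history_congr S₁ S₂ θ x₀ k hω])]
  congr 1
  have e3 : ∀ B : Set Bool, (PMF.uniformOfFintype Bool).toMeasure B =
      (1/2) * (B.indicator 1 true + B.indicator 1 false) := by
    intro B
    rw [PMF.toMeasure_apply_fintype]
    simp [Set.indicator, mul_add]
  rw [e3]
  have m : ∀ c, (c ∈ {c | nextPosition S₁ S₂ θ k h c ∈ A}) ↔
      nextPosition S₁ S₂ θ k h c ∈ A := fun c => Iff.rfl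
  classical
  rw [Set.indicator_apply, Set.indicator_apply]
  simp only [m]
  by_cases hs : θ.sell k h = true <;> by_cases h1 : S₁.move k h ∈ A <;>
    by_cases h2 : S₂.move k h ∈ A <;>
    simp [transition, nextPosition, hs, h1, h2, hA, one_add_one_eq_two,
      ENNReal.inv_mul_cancel,
      ENNReal.inv_two_add_inv_two]

/-- The game ends, i.e. the token hits the boundary strip of `Ω`. -/
def Ends {n : ℕ} (Ω : Set (EuclideanSpace ℝ (Fin n))) {D : Set (EuclideanSpace ℝ (Fin n))} {ε : ℝ}
    (S₁ S₂ : Strategy n ε) (θ : SellingRule D) (x₀ : EuclideanSpace ℝ (Fin n))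
    (ω : ℕ → Bool) : Prop :=
  ∃ k, position S₁ S₂ θ x₀ ω k ∈ boundaryStrip Ω ε

/-- The time `τ` at which the token first hits the boundary strip; it is only meaningful
if the game ends. -/
noncomputable def exitTime {n : ℕ} (Ω : Set (EuclideanSpace ℝ (Fin n)))
    {D : Set (EuclideanSpace ℝ (Fin n))} {ε : ℝ}
    (S₁ S₂ : Strategy n ε) (θ : SellingRule D) (x₀ : EuclideanSpace ℝ (Fin n))
    (ω : ℕ → Bool) : ℕ :=
  sInf {k | position S₁ S₂ θ x₀ ω k ∈ boundaryStrip Ω ε}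

/-- The total payoff `F(x_τ) - ε ∑_{i < τ} θ(x₀, …, x_i)` to Player I. -/
noncomputable def payoff {n : ℕ} (Ω : Set (EuclideanSpace ℝ (Fin n)))
    {D : Set (EuclideanSpace ℝ (Fin n))} {ε : ℝ} (F : EuclideanSpace ℝ (Fin n) → ℝ)
    (S₁ S₂ : Strategy n ε) (θ : SellingRule D) (x₀ : EuclideanSpace ℝ (Fin n))
    (ω : ℕ → Bool) : ℝ :=
  F (position S₁ S₂ θ x₀ ω (exitTime Ω S₁ S₂ θ x₀ ω)) -
    ε * ∑ i ∈ Finset.range (exitTime Ω S₁ S₂ θ x₀ ω),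
      if θ.sell i (history S₁ S₂ θ x₀ ω i) = true then (1 : ℝ) else 0

/-- The expectation `E[f⁺] - E[f⁻]` over the coin tosses, as an extended real number. For a
measurable `f` bounded above, it is `-∞` exactly if `f` is not integrable. -/
noncomputable def expectation (f : (ℕ → Bool) → ℝ) : EReal :=
  ((∫⁻ ω, ENNReal.ofReal (f ω) ∂coinMeasure : ENNReal) : EReal) -
    ((∫⁻ ω, ENNReal.ofReal (-f ω) ∂coinMeasure : ENNReal) : EReal)

open Classical in
/-- The expected payoff, set to be `-∞` if the game does not end almost surely. -/
noncomputable def expectedPayoffI {n : ℕ} (Ω : Set (EuclideanSpace ℝ (Fin n)))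
    {D : Set (EuclideanSpace ℝ (Fin n))} {ε : ℝ} (F : EuclideanSpace ℝ (Fin n) → ℝ)
    (S₁ S₂ : Strategy n ε) (θ : SellingRule D) (x₀ : EuclideanSpace ℝ (Fin n)) : EReal :=
  if ∀ᵐ ω ∂coinMeasure, Ends Ω S₁ S₂ θ x₀ ω then expectation (payoff Ω F S₁ S₂ θ x₀) else ⊥

open Classical in
/-- The expected payoff, set to be `+∞` if the game does not end almost surely. -/
noncomputable def expectedPayoffII {n : ℕ} (Ω : Set (EuclideanSpace ℝ (Fin n)))
    {D : Set (EuclideanSpace ℝ (Fin n))} {ε : ℝ} (F : EuclideanSpace ℝ (Fin n) → ℝ)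
    (S₁ S₂ : Strategy n ε) (θ : SellingRule D) (x₀ : EuclideanSpace ℝ (Fin n)) : EReal :=
  if ∀ᵐ ω ∂coinMeasure, Ends Ω S₁ S₂ θ x₀ ω then expectation (payoff Ω F S₁ S₂ θ x₀) else ⊤

/-- The value for Player I of the game in `Ω` in which turns can be sold in `D`:
`u_I(x₀) = sup_{S_I} inf_{S_II, θ} E[F(x_τ) - ε ∑_{i < τ} θ(x₀, …, x_i)]`. -/
noncomputable def valueI {n : ℕ} (Ω D : Set (EuclideanSpace ℝ (Fin n))) (ε : ℝ)
    (F : EuclideanSpace ℝ (Fin n) → ℝ) (x₀ : EuclideanSpace ℝ (Fin n)) : EReal :=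
  ⨆ S₁ : Strategy n ε, ⨅ S₂ : Strategy n ε, ⨅ θ : SellingRule D,
    expectedPayoffI Ω F S₁ S₂ θ x₀

/-- The value for Player II of the game in `Ω` in which turns can be sold in `D`:
`u_II(x₀) = inf_{S_II, θ} sup_{S_I} E[F(x_τ) - ε ∑_{i < τ} θ(x₀, …, x_i)]`. -/
noncomputable def valueII {n : ℕ} (Ω D : Set (EuclideanSpace ℝ (Fin n))) (ε : ℝ)
    (F : EuclideanSpace ℝ (Fin n) → ℝ) (x₀ : EuclideanSpace ℝ (Fin n)) : EReal :=
  ⨅ S₂ : Strategy n ε, ⨅ θ : SellingRule D, ⨆ S₁ : Strategy n ε,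
    expectedPayoffII Ω F S₁ S₂ θ x₀

/-- The value for Player I of the `Ω`-game, where turns can be sold in the whole of `Ω`. -/
noncomputable def omegaGameValueI {n : ℕ} (Ω : Set (EuclideanSpace ℝ (Fin n))) (ε : ℝ)
    (F : EuclideanSpace ℝ (Fin n) → ℝ) : EuclideanSpace ℝ (Fin n) → EReal :=
  valueI Ω Ω ε F

/-- The value for Player II of the `Ω`-game, where turns can be sold in the whole of `Ω`. -/
noncomputable def omegaGameValueII {n : ℕ} (Ω : Set (EuclideanSpace ℝ (Fin n))) (ε : ℝ)
    (F : EuclideanSpace ℝ (Fin n) → ℝ) : EuclideanSpace ℝ (Fin n) → EReal :=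
  valueII Ω Ω ε F

end TugOfWar

namespace TugOfWar

open Filter Topology

/-! The dynamic programming equation is u = min((sup u + inf u)/2, sup u - ε) in Ω, with sup and inf
over the closed ε-ball and u = F on the strip: Player II takes the better of tossing and selling.
Any bounded solution u satisfies u ≤ u_I ≤ u_II ≤ u, so existence of one suffices and uniqueness is
not needed. Existence (`exists_isSolution`) is a Knaster–Tarski argument: the pointwise supremum of
bounded subsolutions is a fixed point.

For u ≤ u_I (`exists_strategyI_guarantee`), Player I moves to almost maximal points of u. Then u
minus the fees paid, minus a shrinking error, is a submartingale bounded above. Each of her moves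
raises u by at least ε/2, so a long run of won tosses would contradict boundedness; hence the game
ends, and optional stopping applies.

For u_II ≤ u (`exists_strategyII_guarantee`), Player II wants to sell exactly where sup u ≤ u + ε
and to move to almost minimal points elsewhere. Selling forever could let Player I prolong the game,
so only K turns are sold, after which Player II pushes in a fixed direction. The potential is (1 -
l)(u - ε · sales) + lM. Its slack grows with the number of sales and pays for abandoning u after K
of them; finally l tends to 0.

Strategies need no measurability, because everything at time k depends on finitely many tosses.
Conditional expectation given these is replaced by averaging over toss k and its reversal. -/

instance : IsProbabilityMeasure coinMeasure := by
  unfold coinMeasure; infer_instance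

/-! ### Coin flips, supermartingales and optional stopping -/

/-- The sequence of tosses with the `k`-th toss reversed. -/
def flip (k : ℕ) (ω : ℕ → Bool) : ℕ → Bool := Function.update ω k (!ω k)

theorem measurePreserving_flip (k : ℕ) : MeasurePreserving (flip k) coinMeasure coinMeasure := by
  have h : flip k = fun ω i => (if i = k then Bool.not else id) (ω i) := by
    funext ω i
    by_cases hi : i = k
    · subst hi; simp [flip]
    · simp [flip, hi]
  refine ⟨by rw [h]; exact measurable_pi_lambda _ fun i =>
    (measurable_of_countable _).comp (measurable_pi_apply i), ?_⟩
  rw [h]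
  unfold coinMeasure
  rw [Measure.infinitePi_map_pi (fun _ : ℕ => (PMF.uniformOfFintype Bool).toMeasure)
    (fun i => measurable_of_countable _)]
  congr 1
  funext i
  by_cases hi : i = k
  · simp only [hi, if_true]
    ext s hs
    rw [Measure.map_apply (measurable_of_countable _) hs, PMF.toMeasure_apply_fintype,
      PMF.toMeasure_apply_fintype]
    simp [Set.indicator, Set.mem_preimage]
    exact add_comm _ _
  · simp [hi]

/-- Such a function factors through a finite discrete space, so arbitrary strategies cause no
measurability problem. -/
theorem measurable_of_dependsOn_Iio {α : Type*} [MeasurableSpace α] {k : ℕ}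
    {f : (ℕ → Bool) → α} (hf : DependsOn f (Set.Iio k)) : Measurable f := by
  have h : f = (fun g : Finset.range k → Bool =>
      f fun i => if hi : i ∈ Finset.range k then g ⟨i, hi⟩ else false) ∘
      fun ω i => ω i.1 := by
    funext ω
    refine hf fun i hi => ?_
    have : i < k := hi
    simp [this]
  rw [h]
  exact (measurable_of_finite _).comp (measurable_pi_lambda _ fun i => measurable_pi_apply _)

/-- Reversing a toss preserves the measure, so f and its flipped version have the same integral.
This is the substitute for conditioning on the past. -/
theorem lintegral_coin_step (k : ℕ) {f g : (ℕ → Bool) → ENNReal} (hf : Measurable f)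
    (h : ∀ ω, f ω + f (flip k ω) ≤ 2 * g ω) :
    ∫⁻ ω, f ω ∂coinMeasure ≤ ∫⁻ ω, g ω ∂coinMeasure := by
  have h1 : ∫⁻ ω, f (flip k ω) ∂coinMeasure = ∫⁻ ω, f ω ∂coinMeasure :=
    (measurePreserving_flip k).lintegral_comp hf
  have h2 : ∫⁻ ω, (f ω + f (flip k ω)) ∂coinMeasure ≤ ∫⁻ ω, 2 * g ω ∂coinMeasure :=
    lintegral_mono h
  rw [lintegral_add_left hf, h1, lintegral_const_mul' _ _ (by simp), ← two_mul] at h2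
  exact (ENNReal.mul_le_mul_iff_right (by simp) (by simp)).1 h2

/-- Fatou's lemma for nonnegative supermartingales adapted to the tosses. -/
theorem lintegral_le_of_supermartingale (D : ℕ → (ℕ → Bool) → ENNReal)
    (hD : ∀ k, DependsOn (D k) (Set.Iio k))
    (hstep : ∀ k ω, D (k + 1) ω + D (k + 1) (flip k ω) ≤ 2 * D k ω) (d : ENNReal)
    (h0 : ∀ ω, D 0 ω ≤ d) (D' : (ℕ → Bool) → ENNReal)
    (hlim : ∀ᵐ ω ∂coinMeasure, ∀ᶠ k in atTop, D k ω = D' ω) :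
    ∫⁻ ω, D' ω ∂coinMeasure ≤ d := by
  have hm k : Measurable (D k) := measurable_of_dependsOn_Iio (hD k)
  have hk : ∀ k, ∫⁻ ω, D k ω ∂coinMeasure ≤ d := by
    intro k
    induction k with
    | zero => exact (lintegral_mono h0).trans (by simp)
    | succ k ih => exact (lintegral_coin_step k (hm _) (hstep k)).trans ih
  calc ∫⁻ ω, D' ω ∂coinMeasure = ∫⁻ ω, liminf (fun k => D k ω) atTop ∂coinMeasure := by
        refine lintegral_congr_ae ?_
        filter_upwards [hlim] with ω hω
        exact (Tendsto.liminf_eq (tendsto_const_nhds.congr' (hω.mono fun _ h => h.symm))).symm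
    _ ≤ liminf (fun k => ∫⁻ ω, D k ω ∂coinMeasure) atTop := lintegral_liminf_le hm
    _ ≤ liminf (fun _ : ℕ => d) atTop := liminf_le_liminf (Eventually.of_forall hk)
    _ = d := liminf_const _

/-- The process `v` stopped at the first time when `hit` holds. -/
noncomputable def stopped (v : ℕ → (ℕ → Bool) → ℝ) (hit : ℕ → (ℕ → Bool) → Prop) :
    ℕ → (ℕ → Bool) → ℝ
  | 0 => v 0
  | k + 1 => fun ω => open Classical in
      if ∃ j ≤ k, hit j ω then stopped v hit k ω else v (k + 1) ω

section Stopped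

variable {v : ℕ → (ℕ → Bool) → ℝ} {hit : ℕ → (ℕ → Bool) → Prop}

theorem stopped_of_not_hit {k : ℕ} {ω : ℕ → Bool} (h : ∀ j < k, ¬ hit j ω) :
    stopped v hit k ω = v k ω := by
  cases k with
  | zero => rfl
  | succ k =>
    have : ¬ ∃ j ≤ k, hit j ω := by
      rintro ⟨j, hj, h'⟩
      exact h j (by omega) h'
    simp [stopped, this]

theorem stopped_of_hit {t k : ℕ} {ω : ℕ → Bool} (ht : hit t ω) (h : ∀ j < t, ¬ hit j ω)
    (hk : t ≤ k) : stopped v hit k ω = v t ω := by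
  induction k, hk using Nat.le_induction with
  | base => exact stopped_of_not_hit h
  | succ k hk ih =>
    have : ∃ j ≤ k, hit j ω := ⟨t, hk, ht⟩
    simp only [stopped, this, if_true, ih]

theorem stopped_le {B : ℝ} (hB : ∀ k ω, v k ω ≤ B) (k : ℕ) (ω : ℕ → Bool) :
    stopped v hit k ω ≤ B := by
  induction k with
  | zero => exact hB 0 ω
  | succ k ih =>
    simp only [stopped]
    split_ifs
    · exact ih
    · exact hB _ _

theorem dependsOn_stopped (hv : ∀ k, DependsOn (v k) (Set.Iio k))
    (hhit : ∀ k, DependsOn (hit k) (Set.Iio k)) (k : ℕ) :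
    DependsOn (stopped v hit k) (Set.Iio k) := by
  induction k with
  | zero => exact hv 0
  | succ k ih =>
    intro ω ω' h
    have h1 : stopped v hit k ω = stopped v hit k ω' :=
      ih fun i hi => h i (lt_trans (Set.mem_Iio.1 hi) (Nat.lt_succ_self k))
    have h2 : (∃ j ≤ k, hit j ω) ↔ ∃ j ≤ k, hit j ω' := by
      refine exists_congr fun j => and_congr_right fun hj => ?_
      exact iff_of_eq (hhit j fun i hi => h i (Set.mem_Iio.2 (by
        have := Set.mem_Iio.1 hi
        omega)))
    by_cases h' : ∃ j ≤ k, hit j ω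
    · simp only [stopped, h', h2.1 h', if_true, h1]
    · simp only [stopped, h', mt h2.2 h', if_false, hv (k + 1) h]

end Stopped

theorem flip_of_lt {k i : ℕ} (hi : i < k) (ω : ℕ → Bool) : ω i = flip k ω i := by
  simp [flip, hi.ne]

/-- Optional stopping for a submartingale of the tosses that is bounded above. -/
theorem integrable_and_le_integral_of_submartingale
    {v : ℕ → (ℕ → Bool) → ℝ} {hit : ℕ → (ℕ → Bool) → Prop}
    (hv : ∀ k, DependsOn (v k) (Set.Iio k)) (hhit : ∀ k, DependsOn (hit k) (Set.Iio k))
    {B : ℝ} (hB : ∀ k ω, v k ω ≤ B)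
    (hsub : ∀ k ω, (∀ j ≤ k, ¬ hit j ω) → 2 * v k ω ≤ v (k + 1) ω + v (k + 1) (flip k ω))
    {y : ℝ} (hy : ∀ ω, y ≤ v 0 ω) (hend : ∀ᵐ ω ∂coinMeasure, ∃ k, hit k ω)
    {Z : (ℕ → Bool) → ℝ} (hZ : ∀ k ω, hit k ω → (∀ j < k, ¬ hit j ω) → Z ω = v k ω) :
    Integrable Z coinMeasure ∧ y ≤ ∫ ω, Z ω ∂coinMeasure := by
  classical
  set Y := stopped v hit with hYdef
  have hYdep k : DependsOn (Y k) (Set.Iio k) := dependsOn_stopped hv hhit k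
  have hYB k ω : Y k ω ≤ B := stopped_le hB k ω
  have hYlim : ∀ᵐ ω ∂coinMeasure, ∀ᶠ k in atTop, Y k ω = Z ω := by
    filter_upwards [hend] with ω hω
    have h1 : hit (Nat.find hω) ω := Nat.find_spec hω
    have h2 : ∀ j < Nat.find hω, ¬ hit j ω := fun j hj => Nat.find_min hω hj
    filter_upwards [eventually_ge_atTop (Nat.find hω)] with k hk
    rw [hZ _ ω h1 h2, hYdef, stopped_of_hit h1 h2 hk]
  have hYstep k ω : 2 * Y k ω ≤ Y (k + 1) ω + Y (k + 1) (flip k ω) := by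
    have e : ∀ j ≤ k, hit j (flip k ω) = hit j ω := fun j hj =>
      (hhit j fun i hi => (flip_of_lt (lt_of_lt_of_le hi hj) ω)).symm
    have e2 : Y k (flip k ω) = Y k ω := (hYdep k fun i hi => flip_of_lt hi ω).symm
    have e3 : (∃ j ≤ k, hit j (flip k ω)) ↔ ∃ j ≤ k, hit j ω :=
      exists_congr fun j => and_congr_right fun hj => iff_of_eq (e j hj)
    by_cases h : ∃ j ≤ k, hit j ω
    · have h' := e3.2 h
      simp only [hYdef, stopped, h, h', if_true]
      simp only [← hYdef, e2]
      linarith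
    · have h' := mt e3.1 h
      have hk : Y k ω = v k ω := stopped_of_not_hit fun j hj hj' => h ⟨j, hj.le, hj'⟩
      rw [hk]
      simp only [hYdef, stopped, h, h', if_false]
      exact hsub k ω fun j hj hj' => h ⟨j, hj, hj'⟩
  have hZm : AEMeasurable Z coinMeasure := by
    refine aemeasurable_of_tendsto_metrizable_ae (u := atTop) (f := Y)
      (fun k => (measurable_of_dependsOn_Iio (hYdep k)).aemeasurable) ?_
    filter_upwards [hYlim] with ω hω
    exact tendsto_const_nhds.congr' (hω.mono fun _ h => h.symm)
  have hZB : ∀ᵐ ω ∂coinMeasure, Z ω ≤ B := by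
    filter_upwards [hYlim] with ω hω
    obtain ⟨k, hk⟩ := hω.exists
    exact hk ▸ hYB k ω
  have hyB : y ≤ B := (hy fun _ => true).trans (hB _ _)
  -- B minus the stopped process is a nonnegative supermartingale, so Fatou gives integrability and
  -- the bound together, with no lower bound on the process.
  have key : ∫⁻ ω, ENNReal.ofReal (B - Z ω) ∂coinMeasure ≤ ENNReal.ofReal (B - y) := by
    refine lintegral_le_of_supermartingale (fun k ω => ENNReal.ofReal (B - Y k ω)) ?_ ?_ _ ?_ _ ?_
    · intro k ω ω' h
      simp only [hYdep k h]
    · intro k ω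
      rw [← ENNReal.ofReal_add (by linarith [hYB (k + 1) ω]) (by linarith [hYB (k + 1) (flip k ω)]),
        show (2 : ENNReal) = ENNReal.ofReal 2 by simp, ← ENNReal.ofReal_mul (by norm_num)]
      exact ENNReal.ofReal_le_ofReal (by linarith [hYstep k ω])
    · intro ω
      exact ENNReal.ofReal_le_ofReal (by linarith [hy ω, show Y 0 ω = v 0 ω from rfl])
    · filter_upwards [hYlim] with ω hω
      filter_upwards [hω] with k hk
      rw [hk]
  have hnn : 0 ≤ᵐ[coinMeasure] fun ω => B - Z ω := by
    filter_upwards [hZB] with ω hω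
    exact sub_nonneg.2 hω
  have hmeas : AEStronglyMeasurable (fun ω => B - Z ω) coinMeasure :=
    (hZm.const_sub B).aestronglyMeasurable
  have hint : Integrable (fun ω => B - Z ω) coinMeasure :=
    ⟨hmeas, (hasFiniteIntegral_iff_ofReal hnn).2 (key.trans_lt ENNReal.ofReal_lt_top)⟩
  have hintZ : Integrable Z coinMeasure := by
    have := (integrable_const B).sub hint
    refine this.congr (Eventually.of_forall fun ω => ?_)
    simp
  refine ⟨hintZ, ?_⟩
  have h1 : ∫ ω, (B - Z ω) ∂coinMeasure ≤ B - y := by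
    rw [integral_eq_lintegral_of_nonneg_ae hnn hmeas]
    exact ENNReal.toReal_le_of_le_ofReal (by linarith) key
  rw [integral_sub (integrable_const B) hintZ] at h1
  simp at h1
  linarith

theorem expectation_eq_integral {f : (ℕ → Bool) → ℝ} (hf : Integrable f coinMeasure) :
    expectation f = ((∫ ω, f ω ∂coinMeasure : ℝ) : EReal) := by
  have h1 : ∫⁻ ω, ENNReal.ofReal (f ω) ∂coinMeasure ≠ ⊤ := hf.lintegral_lt_top.ne
  have h2 : ∫⁻ ω, ENNReal.ofReal (-f ω) ∂coinMeasure ≠ ⊤ := hf.neg.lintegral_lt_top.ne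
  rw [integral_eq_lintegral_pos_part_sub_lintegral_neg_part hf, expectation, EReal.coe_sub,
    EReal.coe_ennreal_toReal h1, EReal.coe_ennreal_toReal h2]

/-! ### Long runs of equal tosses -/

theorem coinMeasure_inter_run (b : Bool) (k : ℕ) (A : Set (ℕ → Bool))
    (hA : ∀ ω ω', (∀ i < k, ω i = ω' i) → (ω ∈ A ↔ ω' ∈ A)) (N : ℕ) :
    coinMeasure (A ∩ {ω | ∀ i < N, ω (k + i) = b}) = coinMeasure A * (1 / 2) ^ N := by
  induction N with
  | zero => simp
  | succ N ih =>
    have e : A ∩ {ω | ∀ i < N + 1, ω (k + i) = b} =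
        (A ∩ {ω | ∀ i < N, ω (k + i) = b}) ∩ {ω | ω (k + N) ∈ ({b} : Set Bool)} := by
      ext ω
      simp only [Set.mem_inter_iff, Set.mem_ofPred_eq, Set.mem_singleton_iff, and_assoc,
        Nat.forall_lt_succ_right]
    have e3 : (PMF.uniformOfFintype Bool).toMeasure {b} = 1 / 2 := by
      rw [PMF.toMeasure_apply_singleton _ _ (measurableSet_singleton b)]
      simp
    rw [e, coin_indep (k + N) _ _ ?_, ih, e3, pow_succ, mul_assoc]
    intro ω ω' h
    simp only [Set.mem_inter_iff, Set.mem_ofPred_eq]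
    refine and_congr (hA _ _ fun i hi => h i (by omega)) ?_
    refine forall_congr' fun i => imp_congr_right fun hi => ?_
    rw [h (k + i) (by omega)]

/-- Almost surely the same result occurs `N` times in a row after time `m`. -/
theorem ae_exists_run (b : Bool) (N m : ℕ) :
    ∀ᵐ ω ∂coinMeasure, ∃ k ≥ m, ∀ i < N, ω (k + i) = b := by
  -- None of the first j disjoint blocks of length N after time m is constantly b. The blocks are
  -- independent, so this has probability (1 - 2⁻ᴺ)ʲ, which tends to 0.
  set A : ℕ → Set (ℕ → Bool) := fun j => {ω | ∀ l < j, ¬ ∀ i < N, ω (m + l * N + i) = b}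
  have hA j : ∀ ω ω', (∀ i < m + j * N, ω i = ω' i) → (ω ∈ A j ↔ ω' ∈ A j) := by
    intro ω ω' h
    refine forall_congr' fun l => imp_congr_right fun hl => not_congr ?_
    refine forall_congr' fun i => imp_congr_right fun hi => ?_
    have : (l + 1) * N ≤ j * N := Nat.mul_le_mul_right _ hl
    rw [h _ (by linarith)]
  have hAm j : MeasurableSet (A j) := by
    have : DependsOn (fun ω => ω ∈ A j) (Set.Iio (m + j * N)) := fun ω ω' h =>
      propext (hA j ω ω' fun i hi => h i hi)
    exact measurableSet_setOfPred.2 (measurable_of_dependsOn_Iio this)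
  have hstep j : coinMeasure (A (j + 1)) = coinMeasure (A j) * (1 - (1 / 2) ^ N) := by
    have e : A (j + 1) = A j \ (A j ∩ {ω | ∀ i < N, ω (m + j * N + i) = b}) := by
      ext ω
      simp only [A, Set.mem_ofPred_eq, Set.mem_sdiff, Set.mem_inter_iff, not_and,
        Nat.forall_lt_succ_right]
      tauto
    have hB : MeasurableSet (A j ∩ {ω : ℕ → Bool | ∀ i < N, ω (m + j * N + i) = b}) := by
      have e : A j ∩ {ω : ℕ → Bool | ∀ i < N, ω (m + j * N + i) = b} = A j \ A (j + 1) := by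
        rw [e, Set.sdiff_sdiff_right_self]
        simp [Set.inter_comm]
      rw [e]
      exact (hAm _).diff (hAm _)
    rw [e, measure_sdiff Set.inter_subset_left hB.nullMeasurableSet (measure_ne_top _ _),
      coinMeasure_inter_run b _ _ (hA j), ENNReal.mul_sub (by simp), mul_one]
  have hpow j : coinMeasure (A j) = (1 - (1 / 2) ^ N) ^ j := by
    induction j with
    | zero => simp [A]
    | succ j ih => rw [hstep, ih, pow_succ]
  have hlim : Tendsto (fun j : ℕ => (1 - (1 / 2 : ENNReal) ^ N) ^ j) atTop (𝓝 0) := by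
    refine ENNReal.tendsto_pow_atTop_nhds_zero_of_lt_one ?_
    exact ENNReal.sub_lt_self (by simp) (by simp) (by simp)
  have hzero : coinMeasure {ω | ¬ ∃ k ≥ m, ∀ i < N, ω (k + i) = b} = 0 := by
    refine le_antisymm (ge_of_tendsto' hlim fun j => ?_) (zero_le)
    rw [← hpow]
    refine measure_mono fun ω hω l _ h => hω ⟨m + l * N, by simp, h⟩
  exact hzero

theorem ae_exists_runs (b : Bool) :
    ∀ᵐ ω ∂coinMeasure, ∀ N m, ∃ k ≥ m, ∀ i < N, ω (k + i) = b :=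
  ae_all_iff.2 fun N => ae_all_iff.2 fun m => ae_exists_run b N m

/-- A sequence that decreases by a fixed amount at each toss with result `b` is not bounded if
there are arbitrarily long runs of `b`. -/
theorem not_bounded_of_runs {b : Bool} {ω : ℕ → Bool} {m : ℕ}
    (hω : ∀ N m, ∃ k ≥ m, ∀ i < N, ω (k + i) = b)
    {a : ℕ → ℝ} {M c : ℝ} (hc : 0 < c) (ha : ∀ k ≥ m, |a k| ≤ M)
    (hstep : ∀ k ≥ m, ω k = b → a (k + 1) ≤ a k - c) : False := by
  -- N decreases of size c exceed 2M, the length of [-M, M].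
  obtain ⟨N, hN⟩ := exists_nat_gt (2 * M / c)
  obtain ⟨k, hk, hrun⟩ := hω N m
  have h : ∀ i ≤ N, a (k + i) ≤ a k - i * c := by
    intro i
    induction i with
    | zero => simp
    | succ i ih =>
      intro hi
      have h1 := hstep (k + i) (by omega) (hrun i (by omega))
      have h2 := ih (by omega)
      push_cast
      rw [← add_assoc]
      linarith
  have h1 := h N le_rfl
  rw [div_lt_iff₀ hc] at hN
  have h2 := abs_le.1 (ha k hk)
  have h3 := abs_le.1 (ha (k + N) (by omega))
  linarith

/-! ### Bounded solutions of the dynamic programming equation -/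

section ValueIteration

variable {n : ℕ} {Ω : Set (EuclideanSpace ℝ (Fin n))} {ε : ℝ}

/-- A step from `Ω` leads into `Ω` or into its boundary strip. -/
theorem mem_union_boundaryStrip_of_mem_closedBall (hΩ : IsOpen Ω)
    {x y : EuclideanSpace ℝ (Fin n)} (hx : x ∈ Ω) (hy : y ∈ Metric.closedBall x ε) :
    y ∈ Ω ∪ boundaryStrip Ω ε := by
  by_cases hyΩ : y ∈ Ω
  · exact Or.inl hyΩ
  refine Or.inr ⟨hyΩ, ?_⟩
  have hxy : x ≠ y := fun h => hyΩ (h ▸ hx)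
  obtain ⟨p, hp, hpd⟩ := exists_mem_frontier_infDist_compl_eq_dist (s := Ωᶜ) hyΩ
    (fun h => (h ▸ Set.mem_univ x : x ∈ Ωᶜ) hx)
  rw [compl_compl] at hpd
  rw [frontier_compl] at hp
  have hcont : ContinuousAt (fun t : ℝ => AffineMap.lineMap x y t) 0 :=
    (AffineMap.lineMap_continuous (p := x) (q := y)).continuousAt
  -- Openness of Ω provides a point of Ω on the segment strictly closer to y than x is. This yields
  -- the strict inequality in the definition of the strip although the ball is closed.
  have hev : ∀ᶠ t in 𝓝[>] (0 : ℝ), AffineMap.lineMap x y t ∈ Ω := by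
    refine nhdsWithin_le_nhds (hcont.eventually_mem (hΩ.mem_nhds ?_))
    simpa using hx
  obtain ⟨t, ht, ht0, ht1⟩ := (hev.and (Ioo_mem_nhdsGT (zero_lt_one' ℝ))).exists
  calc Metric.infDist y (frontier Ω) ≤ dist y p := Metric.infDist_le_dist_of_mem hp
    _ = Metric.infDist y Ω := hpd.symm
    _ ≤ dist y (AffineMap.lineMap x y t) := Metric.infDist_le_dist_of_mem ht
    _ = (1 - t) * dist x y := by
        rw [dist_right_lineMap, Real.norm_of_nonneg (by linarith)]
    _ < 1 * dist x y := by
        have := dist_pos.2 hxy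
        gcongr
        linarith
    _ ≤ ε := by rw [one_mul, dist_comm]; exact hy

/-- The operator of the dynamic programming principle of the game, with boundary values `G`. -/
noncomputable def bellman (Ω : Set (EuclideanSpace ℝ (Fin n))) (ε : ℝ)
    (G u : EuclideanSpace ℝ (Fin n) → ℝ) (x : EuclideanSpace ℝ (Fin n)) : ℝ :=
  open Classical in
  if x ∈ Ω then
    min ((sSup (u '' Metric.closedBall x ε) + sInf (u '' Metric.closedBall x ε)) / 2)
      (sSup (u '' Metric.closedBall x ε) - ε)
  else G x

section Bounds

variable {w w' : EuclideanSpace ℝ (Fin n) → ℝ} {a b : ℝ} {x y : EuclideanSpace ℝ (Fin n)}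

theorem bddAbove_image_of_le (hw : ∀ x, w x ≤ b) (s : Set (EuclideanSpace ℝ (Fin n))) :
    BddAbove (w '' s) := ⟨b, by rintro _ ⟨z, -, rfl⟩; exact hw z⟩

theorem bddBelow_image_of_le (hw : ∀ x, a ≤ w x) (s : Set (EuclideanSpace ℝ (Fin n))) :
    BddBelow (w '' s) := ⟨a, by rintro _ ⟨z, -, rfl⟩; exact hw z⟩

/-- The bounds on w and w' are what make the real-valued suprema and infima monotone. -/
theorem bellman_mono (hε : 0 < ε) {G : EuclideanSpace ℝ (Fin n) → ℝ}
    (hw : ∀ x, a ≤ w x) (hw' : ∀ x, w' x ≤ b) (h : ∀ x, w x ≤ w' x) :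
    bellman Ω ε G w x ≤ bellman Ω ε G w' x := by
  have hne (f : EuclideanSpace ℝ (Fin n) → ℝ) : (f '' Metric.closedBall x ε).Nonempty :=
    (Metric.nonempty_closedBall.2 hε.le).image f
  have h1 : sSup (w '' Metric.closedBall x ε) ≤ sSup (w' '' Metric.closedBall x ε) := by
    refine csSup_le (hne w) ?_
    rintro _ ⟨z, hz, rfl⟩
    exact (h z).trans (le_csSup (bddAbove_image_of_le hw' _) ⟨z, hz, rfl⟩)
  have h2 : sInf (w '' Metric.closedBall x ε) ≤ sInf (w' '' Metric.closedBall x ε) := by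
    refine le_csInf (hne w') ?_
    rintro _ ⟨z, hz, rfl⟩
    exact (csInf_le (bddBelow_image_of_le hw _) ⟨z, hz, rfl⟩).trans (h z)
  unfold bellman
  split_ifs
  · gcongr
  · exact le_rfl

/-- A bounded subsolution below the bound `b` yields a bounded solution. -/
theorem exists_bellman_eq (hε : 0 < ε) {G : EuclideanSpace ℝ (Fin n) → ℝ} (hG : ∀ x, G x ≤ b)
    {w₀ : EuclideanSpace ℝ (Fin n) → ℝ} (ha : ∀ x, a ≤ w₀ x) (hb : ∀ x, w₀ x ≤ b)
    (hw₀ : ∀ x, w₀ x ≤ bellman Ω ε G w₀ x) :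
    ∃ u : EuclideanSpace ℝ (Fin n) → ℝ, (∀ x, a ≤ u x) ∧ (∀ x, u x ≤ b) ∧
      ∀ x, u x = bellman Ω ε G u x := by
  -- Subsolutions between w₀ and b; the lower barrier w₀ keeps all of them uniformly bounded below.
  set S : Set (EuclideanSpace ℝ (Fin n) → ℝ) :=
    {w | (∀ x, w₀ x ≤ w x) ∧ (∀ x, w x ≤ b) ∧ ∀ x, w x ≤ bellman Ω ε G w x} with hS
  have hS0 : w₀ ∈ S := ⟨fun _ => le_rfl, hb, hw₀⟩
  have hSb : BddAbove S := ⟨fun _ => b, fun w hw x => hw.2.1 x⟩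
  set u := sSup S
  have hle : ∀ w ∈ S, ∀ x, w x ≤ u x := fun w hw => le_csSup hSb hw
  have hub : ∀ x, u x ≤ b := csSup_le (a := fun _ => b) ⟨w₀, hS0⟩ fun w hw x => hw.2.1 x
  have hu1 : ∀ x, u x ≤ bellman Ω ε G u x :=
    csSup_le (a := bellman Ω ε G u) ⟨w₀, hS0⟩ fun w hw x => (hw.2.2 x).trans
      (bellman_mono hε (fun z => (ha z).trans (hw.1 z)) hub (hle w hw))
  have hua : ∀ x, a ≤ u x := fun x => (ha x).trans (hle w₀ hS0 x)
  have hTb : ∀ x, bellman Ω ε G u x ≤ b := by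
    intro x
    unfold bellman
    split_ifs
    · refine (min_le_right _ _).trans ?_
      have : sSup (u '' Metric.closedBall x ε) ≤ b := by
        refine csSup_le ((Metric.nonempty_closedBall.2 hε.le).image u) ?_
        rintro _ ⟨z, -, rfl⟩
        exact hub z
      linarith
    · exact hG x
  -- The operator maps the largest subsolution to a subsolution, which is therefore no larger; this
  -- is the reverse inequality.
  have hT : bellman Ω ε G u ∈ S :=
    ⟨fun x => (hle w₀ hS0 x).trans (hu1 x), hTb, fun x => bellman_mono hε hua hTb hu1⟩
  exact ⟨u, hua, hub, fun x => le_antisymm (hu1 x) (hle _ hT x)⟩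

end Bounds

open Classical in
-- A coordinate function has slope one: over an ε-ball it rises by ε and falls by ε, so it satisfies
-- both alternatives of the minimum with equality. Lowered far enough, it can be continued by -C
-- outside Ω.
theorem exists_bellman_subsolution (hn : 1 ≤ n) (hΩ : Bornology.IsBounded Ω) (hε : 0 < ε)
    {G : EuclideanSpace ℝ (Fin n) → ℝ} {C : ℝ} (hG : ∀ x, |G x| ≤ C) :
    ∃ (w : EuclideanSpace ℝ (Fin n) → ℝ) (a : ℝ), (∀ x, a ≤ w x) ∧ (∀ x, w x ≤ C) ∧
      ∀ x, w x ≤ bellman Ω ε G w x := by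
  obtain ⟨R, hR0, hR⟩ := hΩ.exists_pos_norm_le
  set i : Fin n := ⟨0, hn⟩
  have hcoord (x : EuclideanSpace ℝ (Fin n)) : |x i| ≤ ‖x‖ := PiLp.norm_apply_le x i
  have hC : 0 ≤ C := (abs_nonneg _).trans (hG 0)
  -- Within ε of Ω the coordinate is at most R + ε, so there the shifted coordinate is at most -C.
  set c := R + ε + C with hc
  set w : EuclideanSpace ℝ (Fin n) → ℝ := fun x => if x ∈ Ω then x i - c else -C with hw
  have hlow : ∀ x, -R - c ≤ w x := by
    intro x
    simp only [hw]
    split_ifs with hx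
    · linarith [abs_le.1 ((hcoord x).trans (hR x hx))]
    · linarith
  have hup : ∀ x, w x ≤ C := by
    intro x
    simp only [hw]
    split_ifs with hx
    · linarith [abs_le.1 ((hcoord x).trans (hR x hx))]
    · linarith
  have hball : ∀ x ∈ Ω, ∀ y ∈ Metric.closedBall x ε, y i - c ≤ w y := by
    intro x hx y hy
    have h1 := abs_le.1 ((hcoord x).trans (hR x hx))
    have h2 := abs_le.1 ((hcoord (y - x)).trans (mem_closedBall_iff_norm.1 hy))
    simp only [PiLp.sub_apply] at h2
    simp only [hw]
    split_ifs
    · exact le_rfl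
    · linarith
  refine ⟨w, -R - c, hlow, hup, fun x => ?_⟩
  by_cases hx : x ∈ Ω
  · have hwx : w x = x i - c := by simp [hw, hx]
    have hmem : x + EuclideanSpace.single i ε ∈ Metric.closedBall x ε := by
      simp [abs_of_pos hε]
    have h1 : x i + ε - c ≤ sSup (w '' Metric.closedBall x ε) := by
      refine le_trans ?_ (le_csSup (bddAbove_image_of_le hup _) ⟨_, hmem, rfl⟩)
      simpa using hball x hx _ hmem
    have h2 : x i - ε - c ≤ sInf (w '' Metric.closedBall x ε) := by
      refine le_csInf ((Metric.nonempty_closedBall.2 hε.le).image w) ?_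
      rintro _ ⟨y, hy, rfl⟩
      have h2 := abs_le.1 ((hcoord (y - x)).trans (mem_closedBall_iff_norm.1 hy))
      simp only [PiLp.sub_apply] at h2
      linarith [hball x hx y hy]
    rw [bellman, if_pos hx, hwx]
    exact le_min (by linarith) (by linarith)
  · rw [bellman, if_neg hx]
    simp only [hw, hx, if_false]
    exact (abs_le.1 (hG x)).1

/-- A bounded solution of the dynamic programming principle, in terms of almost optimal moves. -/
structure IsSolution (Ω : Set (EuclideanSpace ℝ (Fin n))) (ε : ℝ)
    (F u : EuclideanSpace ℝ (Fin n) → ℝ) : Prop where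
  bounded : ∃ M, 0 ≤ M ∧ ∀ x, |u x| ≤ M
  boundary : ∀ x ∈ boundaryStrip Ω ε, u x = F x
  exists_up : ∀ x ∈ Ω, ∀ δ > 0, ∃ y ∈ Metric.closedBall x ε,
    u x + ε ≤ u y + δ ∧ ∀ z ∈ Metric.closedBall x ε, 2 * u x ≤ u y + u z + δ
  exists_down : ∀ x ∈ Ω, (¬ ∀ y ∈ Metric.closedBall x ε, u y ≤ u x + ε) → ∀ δ > 0,
    ∃ z ∈ Metric.closedBall x ε,
      u z + ε ≤ u x + δ ∧ ∀ y ∈ Metric.closedBall x ε, u y + u z ≤ 2 * u x + δ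

/-- The bound u ≤ sup u - ε always holds, so a near-maximal move gains almost ε. If some value
exceeds u + ε, the selling alternative is not the minimum; then u is the midpoint of sup and inf,
and a near-minimal move loses almost ε or more. -/
theorem isSolution_of_bellman_eq (hε : 0 < ε) {G F u : EuclideanSpace ℝ (Fin n) → ℝ} {a b : ℝ}
    (hG : ∀ x ∈ boundaryStrip Ω ε, G x = F x) (ha : ∀ x, a ≤ u x) (hb : ∀ x, u x ≤ b)
    (hu : ∀ x, u x = bellman Ω ε G u x) : IsSolution Ω ε F u := by
  have hsup x {y} (hy : y ∈ Metric.closedBall x ε) : u y ≤ sSup (u '' Metric.closedBall x ε) :=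
    le_csSup (bddAbove_image_of_le hb _) ⟨y, hy, rfl⟩
  have hinf x {y} (hy : y ∈ Metric.closedBall x ε) : sInf (u '' Metric.closedBall x ε) ≤ u y :=
    csInf_le (bddBelow_image_of_le ha _) ⟨y, hy, rfl⟩
  have hne x : (u '' Metric.closedBall x ε).Nonempty :=
    (Metric.nonempty_closedBall.2 hε.le).image u
  refine ⟨⟨max |a| |b|, by positivity, fun x => abs_le_max_abs_abs (ha x) (hb x)⟩,
    fun x hx => ?_, fun x hx δ hδ => ?_, fun x hx hP δ hδ => ?_⟩
  · rw [hu x, bellman, if_neg hx.1, hG x hx]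
  · obtain ⟨_, ⟨y, hy, rfl⟩, hlt⟩ := exists_lt_of_lt_csSup (hne x)
      (show sSup (u '' Metric.closedBall x ε) - δ < sSup (u '' Metric.closedBall x ε) by linarith)
    have hux := hu x
    rw [bellman, if_pos hx] at hux
    have h1 := hux.le.trans (min_le_left _ _)
    have h2 := hux.le.trans (min_le_right _ _)
    exact ⟨y, hy, by linarith, fun z hz => by linarith [hinf x hz]⟩
  · obtain ⟨_, ⟨z, hz, rfl⟩, hlt⟩ := exists_lt_of_csInf_lt (hne x)
      (show sInf (u '' Metric.closedBall x ε) < sInf (u '' Metric.closedBall x ε) + δ by linarith)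
    push Not at hP
    obtain ⟨y, hy, hyx⟩ := hP
    have h3 := hsup x hy
    have hux := hu x
    rw [bellman, if_pos hx] at hux
    rcases min_choice ((sSup (u '' Metric.closedBall x ε) + sInf (u '' Metric.closedBall x ε)) / 2)
      (sSup (u '' Metric.closedBall x ε) - ε) with h | h
    · rw [h] at hux
      exact ⟨z, hz, by linarith, fun y' hy' => by linarith [hsup x hy']⟩
    -- Here sup u = u x + ε, which contradicts the value u y > u x + ε.
    · rw [h] at hux
      linarith

theorem exists_isSolution (hn : 1 ≤ n) (hΩ : Bornology.IsBounded Ω) (hε : 0 < ε)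
    {F : EuclideanSpace ℝ (Fin n) → ℝ} (hF : ∃ C : ℝ, ∀ x ∈ boundaryStrip Ω ε, |F x| ≤ C) :
    ∃ u, IsSolution Ω ε F u := by
  classical
  obtain ⟨C, hC⟩ := hF
  set G : EuclideanSpace ℝ (Fin n) → ℝ := (boundaryStrip Ω ε).indicator F
  have hG : ∀ x, |G x| ≤ max C 0 := by
    intro x
    by_cases hx : x ∈ boundaryStrip Ω ε
    · simpa [G, hx] using Or.inl (hC x hx)
    · simp [G, hx]
  obtain ⟨w, a, ha, hb, hw⟩ := exists_bellman_subsolution hn hΩ hε hG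
  obtain ⟨u, hua, hub, hu⟩ := exists_bellman_eq hε (fun x => (abs_le.1 (hG x)).2) ha hb hw
  exact ⟨u, isSolution_of_bellman_eq hε (fun x hx => by simp [G, hx]) hua hub hu⟩

end ValueIteration

/-- The form of optional stopping used for both players: a potential V controls the play before the
end and is compared with the actual payoff P only at the end. -/
theorem integrable_and_le_integral_at_hit
    {V P : ℕ → (ℕ → Bool) → ℝ} {hit : ℕ → (ℕ → Bool) → Prop}
    (hV : ∀ k, DependsOn (V k) (Set.Iio k)) (hP : ∀ k, DependsOn (P k) (Set.Iio k))
    (hhit : ∀ k, DependsOn (hit k) (Set.Iio k))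
    {B : ℝ} (hVB : ∀ k ω, V k ω ≤ B) (hPB : ∀ k ω, hit k ω → P k ω ≤ B)
    (hVP : ∀ k ω, hit k ω → V k ω ≤ P k ω)
    (hsub : ∀ k ω, (∀ j ≤ k, ¬ hit j ω) → 2 * V k ω ≤ V (k + 1) ω + V (k + 1) (flip k ω))
    {y : ℝ} (hy : ∀ ω, y ≤ V 0 ω) (hend : ∀ᵐ ω ∂coinMeasure, ∃ k, hit k ω) :
    Integrable (fun ω => P (sInf {k | hit k ω}) ω) coinMeasure ∧
      y ≤ ∫ ω, P (sInf {k | hit k ω}) ω ∂coinMeasure := by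
  classical
  -- Switching to P at hits only increases the process, so the submartingale inequality before the
  -- first hit survives.
  set v : ℕ → (ℕ → Bool) → ℝ := fun k ω => if hit k ω then P k ω else V k ω with hv
  have hle k ω : V k ω ≤ v k ω := by
    simp only [hv]
    split_ifs with h
    · exact hVP k ω h
    · exact le_rfl
  refine integrable_and_le_integral_of_submartingale (v := v) (hit := hit) (B := B)
    (fun k ω ω' h => ?_) hhit (fun k ω => ?_) (fun k ω h => ?_) (fun ω => (hy ω).trans (hle 0 ω))
    hend (fun k ω h h' => ?_)
  · simp only [hv, hV k h, hP k h, hhit k h]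
  · simp only [hv]
    split_ifs with h
    · exact hPB k ω h
    · exact hVB k ω
  · have e : v k ω = V k ω := by simp [hv, h k le_rfl]
    rw [e]
    exact (hsub k ω h).trans (add_le_add (hle _ _) (hle _ _))
  · have e : sInf {k | hit k ω} = k := by
      refine le_antisymm (Nat.sInf_le h) (le_csInf ⟨k, h⟩ fun j hj => ?_)
      by_contra hjk
      exact h' j (not_le.1 hjk) hj
    simp [e, hv, h]

/-! ### Trajectories of the game -/

section Game

variable {n : ℕ} {Ω D : Set (EuclideanSpace ℝ (Fin n))} {ε : ℝ}
  {S₁ S₂ : Strategy n ε} {θ : SellingRule D} {x₀ : EuclideanSpace ℝ (Fin n)}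

theorem position_succ (ω : ℕ → Bool) (k : ℕ) :
    position S₁ S₂ θ x₀ ω (k + 1) =
      nextPosition S₁ S₂ θ k (history S₁ S₂ θ x₀ ω k) (ω k) := by
  simp [position, history]

theorem history_castSucc (ω : ℕ → Bool) (k : ℕ) (i : Fin (k + 1)) :
    history S₁ S₂ θ x₀ ω k i = position S₁ S₂ θ x₀ ω i := by
  induction k with
  | zero =>
    obtain ⟨i, hi⟩ := i
    obtain rfl : i = 0 := by omega
    rfl
  | succ k ih =>
    refine Fin.lastCases ?_ (fun j => ?_) i
    · rfl
    · simp [history, ih]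

theorem history_flip {k j : ℕ} (hj : j ≤ k) (ω : ℕ → Bool) :
    history S₁ S₂ θ x₀ (flip k ω) j = history S₁ S₂ θ x₀ ω j :=
  history_congr S₁ S₂ θ x₀ j fun _ hi => (flip_of_lt (hi.trans_le hj) ω).symm

theorem position_flip {k j : ℕ} (hj : j ≤ k) (ω : ℕ → Bool) :
    position S₁ S₂ θ x₀ (flip k ω) j = position S₁ S₂ θ x₀ ω j := by
  rw [position, history_flip hj, position]

theorem position_congr {ω ω' : ℕ → Bool} {k j : ℕ} (hj : j ≤ k) (h : ∀ i < k, ω i = ω' i) :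
    position S₁ S₂ θ x₀ ω j = position S₁ S₂ θ x₀ ω' j := by
  rw [position, history_congr S₁ S₂ θ x₀ j fun i hi => h i (hi.trans_le hj), position]

/-- The two equally likely next positions. -/
theorem position_succ_cases (ω : ℕ → Bool) (k : ℕ) :
    let h := history S₁ S₂ θ x₀ ω k
    let y := position S₁ S₂ θ x₀ ω (k + 1)
    let y' := position S₁ S₂ θ x₀ (flip k ω) (k + 1)
    (θ.sell k h = true ∧ y = S₁.move k h ∧ y' = S₁.move k h) ∨
      (θ.sell k h = false ∧ ((y = S₁.move k h ∧ y' = S₂.move k h) ∨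
        (y = S₂.move k h ∧ y' = S₁.move k h))) := by
  intro h y y'
  have e : flip k ω k = !ω k := by simp [flip]
  simp only [y, y', position_succ, history_flip le_rfl, e, nextPosition, h]
  cases θ.sell k (history S₁ S₂ θ x₀ ω k) <;> cases ω k <;> simp

theorem position_succ_of_true {ω : ℕ → Bool} {k : ℕ} (h : ω k = true) :
    position S₁ S₂ θ x₀ ω (k + 1) = S₁.move k (history S₁ S₂ θ x₀ ω k) := by
  simp [position_succ, nextPosition, h]

theorem position_succ_of_false {ω : ℕ → Bool} {k : ℕ} (h : ω k = false)
    (hs : θ.sell k (history S₁ S₂ θ x₀ ω k) = false) :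
    position S₁ S₂ θ x₀ ω (k + 1) = S₂.move k (history S₁ S₂ θ x₀ ω k) := by
  simp [position_succ, nextPosition, h, hs]

theorem position_succ_mem_closedBall (ω : ℕ → Bool) (k : ℕ) :
    position S₁ S₂ θ x₀ ω (k + 1) ∈ Metric.closedBall (position S₁ S₂ θ x₀ ω k) ε := by
  rw [position_succ, nextPosition]
  split_ifs
  · exact S₁.move_mem k _
  · exact S₁.move_mem k _
  · exact S₂.move_mem k _

theorem position_mem_of_not_hit (hΩ : IsOpen Ω) (hx₀ : x₀ ∈ Ω ∪ boundaryStrip Ω ε)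
    {ω : ℕ → Bool} {k : ℕ} (h : ∀ j ≤ k, position S₁ S₂ θ x₀ ω j ∉ boundaryStrip Ω ε) :
    position S₁ S₂ θ x₀ ω k ∈ Ω := by
  induction k with
  | zero => exact hx₀.resolve_right (h 0 le_rfl)
  | succ k ih =>
    exact (mem_union_boundaryStrip_of_mem_closedBall hΩ (ih fun j hj => h j (by omega))
      (position_succ_mem_closedBall ω k)).resolve_right (h (k + 1) le_rfl)

/-- The number of turns sold before time `k`. -/
noncomputable def sold (S₁ S₂ : Strategy n ε) (θ : SellingRule D)
    (x₀ : EuclideanSpace ℝ (Fin n)) (k : ℕ) (ω : ℕ → Bool) : ℝ :=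
  ∑ i ∈ Finset.range k, if θ.sell i (history S₁ S₂ θ x₀ ω i) = true then (1 : ℝ) else 0

theorem sold_nonneg (k : ℕ) (ω : ℕ → Bool) : 0 ≤ sold S₁ S₂ θ x₀ k ω :=
  Finset.sum_nonneg fun i _ => by split_ifs <;> norm_num

theorem sold_congr {ω ω' : ℕ → Bool} {k : ℕ} (h : ∀ i < k, ω i = ω' i) :
    sold S₁ S₂ θ x₀ k ω = sold S₁ S₂ θ x₀ k ω' := by
  refine Finset.sum_congr rfl fun i hi => ?_
  have hi := Finset.mem_range.1 hi
  rw [history_congr S₁ S₂ θ x₀ i fun j hj => h j (hj.trans hi)]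

theorem sold_succ (k : ℕ) (ω : ℕ → Bool) : sold S₁ S₂ θ x₀ (k + 1) ω =
    sold S₁ S₂ θ x₀ k ω + if θ.sell k (history S₁ S₂ θ x₀ ω k) = true then (1 : ℝ) else 0 :=
  Finset.sum_range_succ _ _

theorem sold_succ_flip (k : ℕ) (ω : ℕ → Bool) :
    sold S₁ S₂ θ x₀ (k + 1) (flip k ω) = sold S₁ S₂ θ x₀ (k + 1) ω := by
  rw [sold_succ, sold_succ, history_flip le_rfl,
    sold_congr fun i hi => (flip_of_lt hi ω).symm]

theorem dependsOn_hit (k : ℕ) :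
    DependsOn (fun ω => position S₁ S₂ θ x₀ ω k ∈ boundaryStrip Ω ε) (Set.Iio k) := by
  intro ω ω' h
  simp only [position_congr (S₁ := S₁) (S₂ := S₂) (θ := θ) (x₀ := x₀) le_rfl h]

theorem dependsOn_payoff (F : EuclideanSpace ℝ (Fin n) → ℝ) (k : ℕ) :
    DependsOn (fun ω => F (position S₁ S₂ θ x₀ ω k) - ε * sold S₁ S₂ θ x₀ k ω) (Set.Iio k) := by
  intro ω ω' h
  simp only [position_congr (S₁ := S₁) (S₂ := S₂) (θ := θ) (x₀ := x₀) le_rfl h,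
    sold_congr (S₁ := S₁) (S₂ := S₂) (θ := θ) (x₀ := x₀) h]

/-- The strategy of always making a move that depends only on the time and on the position. -/
def Strategy.ofMove (f : ℕ → EuclideanSpace ℝ (Fin n) → EuclideanSpace ℝ (Fin n))
    (hf : ∀ k x, f k x ∈ Metric.closedBall x ε) : Strategy n ε where
  move k h := f k (h (Fin.last k))
  move_mem _ _ := hf _ _

/-! ### Player I's guarantee -/

/-- Player I guarantees a bounded solution up to `η` by moving to almost maximal points. -/
theorem exists_strategyI_guarantee (hΩ : IsOpen Ω) (hε : 0 < ε)
    {F u : EuclideanSpace ℝ (Fin n) → ℝ} (hu : IsSolution Ω ε F u)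
    {x₀ : EuclideanSpace ℝ (Fin n)} (hx₀ : x₀ ∈ Ω ∪ boundaryStrip Ω ε)
    {η : ℝ} (hη : 0 < η) (hηε : η ≤ ε) :
    ∃ S₁ : Strategy n ε, ∀ (S₂ : Strategy n ε) (θ : SellingRule D),
      ((u x₀ - η : ℝ) : EReal) ≤ expectedPayoffI Ω F S₁ S₂ θ x₀ := by
  obtain ⟨M, hM0, hM⟩ := hu.bounded
  -- The remaining error budget: turn k may lose e k / 2 = e k - e (k + 1), so all losses together
  -- stay below η.
  set e : ℕ → ℝ := fun k => η / 2 ^ k with he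
  have hepos k : 0 < e k := by positivity
  have heη k : e k ≤ η := div_le_self hη.le (one_le_pow₀ (by norm_num))
  have hestep k : e (k + 1) = e k / 2 := by simp only [he, pow_succ]; field_simp
  have hup : ∀ k x, ∃ y ∈ Metric.closedBall x ε, x ∈ Ω → (u x + ε ≤ u y + e k / 2 ∧
      ∀ z ∈ Metric.closedBall x ε, 2 * u x ≤ u y + u z + e k / 2) := by
    intro k x
    by_cases hx : x ∈ Ω
    · obtain ⟨y, hy, h⟩ := hu.exists_up x hx (e k / 2) (half_pos (hepos k))
      exact ⟨y, hy, fun _ => h⟩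
    · exact ⟨x, Metric.mem_closedBall_self hε.le, fun h => absurd h hx⟩
  choose up hupmem hup using hup
  refine ⟨Strategy.ofMove up hupmem, fun S₂ θ => ?_⟩
  set S₁ := Strategy.ofMove up hupmem
  have hmove ω k : S₁.move k (history S₁ S₂ θ x₀ ω k) = up k (position S₁ S₂ θ x₀ ω k) := rfl
  have hend : ∀ᵐ ω ∂coinMeasure, Ends Ω S₁ S₂ θ x₀ ω := by
    filter_upwards [ae_exists_runs true] with ω hω
    by_contra hnot
    have hin k : position S₁ S₂ θ x₀ ω k ∈ Ω :=
      position_mem_of_not_hit hΩ hx₀ fun j _ hj => hnot ⟨j, hj⟩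
    -- Since e k ≤ η ≤ ε, the error is at most ε/2, so each toss won by Player I raises u by at
    -- least ε/2.
    refine not_bounded_of_runs (m := 0) (fun N m => hω N m) (a := fun k => -u (position S₁ S₂ θ x₀ ω k))
      (half_pos hε) (fun k _ => by rw [abs_neg]; exact hM _) fun k _ hk => ?_
    rw [position_succ_of_true hk, hmove]
    linarith [(hup k _ (hin k)).1, heη k]
  have hFu k ω (h : position S₁ S₂ θ x₀ ω k ∈ boundaryStrip Ω ε) :
      F (position S₁ S₂ θ x₀ ω k) = u (position S₁ S₂ θ x₀ ω k) := (hu.boundary _ h).symm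
  have key := integrable_and_le_integral_at_hit
    (V := fun k ω => u (position S₁ S₂ θ x₀ ω k) - ε * sold S₁ S₂ θ x₀ k ω - e k)
    (P := fun k ω => F (position S₁ S₂ θ x₀ ω k) - ε * sold S₁ S₂ θ x₀ k ω)
    (hit := fun k ω => position S₁ S₂ θ x₀ ω k ∈ boundaryStrip Ω ε) (B := M) (y := u x₀ - η)
    (fun k ω ω' h => congrArg (· - e k) (dependsOn_payoff u k h)) (dependsOn_payoff F)
    dependsOn_hit
    (fun k ω => ?_) (fun k ω h => ?_) (fun k ω h => ?_) (fun k ω h => ?_) (fun ω => ?_) hend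
  · rw [expectedPayoffI, if_pos hend]
    have e1 : (payoff Ω F S₁ S₂ θ x₀) = fun ω =>
        F (position S₁ S₂ θ x₀ ω (sInf {k | position S₁ S₂ θ x₀ ω k ∈ boundaryStrip Ω ε})) -
          ε * sold S₁ S₂ θ x₀ (sInf {k | position S₁ S₂ θ x₀ ω k ∈ boundaryStrip Ω ε}) ω := rfl
    rw [e1, expectation_eq_integral key.1]
    exact EReal.coe_le_coe key.2
  · have := mul_nonneg hε.le (sold_nonneg (S₁ := S₁) (S₂ := S₂) (θ := θ) (x₀ := x₀) k ω)
    linarith [(abs_le.1 (hM (position S₁ S₂ θ x₀ ω k))).2, hepos k]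
  · have := mul_nonneg hε.le (sold_nonneg (S₁ := S₁) (S₂ := S₂) (θ := θ) (x₀ := x₀) k ω)
    simp only [hFu k ω h]
    linarith [(abs_le.1 (hM (position S₁ S₂ θ x₀ ω k))).2]
  · simp only [hFu k ω h]
    linarith [hepos k]
  · have hx := position_mem_of_not_hit hΩ hx₀ h
    obtain ⟨h1, h2⟩ := hup k _ hx
    have h3 := h2 _ (S₂.move_mem k (history S₁ S₂ θ x₀ ω k))
    simp only [sold_succ_flip]
    simp only [sold_succ, hestep]
    rcases position_succ_cases (S₁ := S₁) (S₂ := S₂) (θ := θ) (x₀ := x₀) ω k with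
      ⟨hs, hy, hy'⟩ | ⟨hs, ⟨hy, hy'⟩ | ⟨hy, hy'⟩⟩
    all_goals
      rw [hy, hy', hmove, hs]
      simp
      linarith [hepos k]
  · simp [position, history, sold, he]

/-! ### Selling finitely many turns and Player II's guarantee -/

/-- The number of times before time `k` at which the partial history `h` is in `P`. -/
noncomputable def visits (P : Set (EuclideanSpace ℝ (Fin n))) (k : ℕ)
    (h : Fin (k + 1) → EuclideanSpace ℝ (Fin n)) : ℕ :=
  open Classical in ∑ i : Fin k, if h i.castSucc ∈ P then 1 else 0

theorem visits_history (P : Set (EuclideanSpace ℝ (Fin n))) (ω : ℕ → Bool) (k : ℕ) :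
    visits P k (history S₁ S₂ θ x₀ ω k) = open Classical in
      ∑ i ∈ Finset.range k, if position S₁ S₂ θ x₀ ω i ∈ P then 1 else 0 := by
  classical
  rw [visits, ← Fin.sum_univ_eq_sum_range
    (fun i => if position S₁ S₂ θ x₀ ω i ∈ P then 1 else 0)]
  refine Finset.sum_congr rfl fun i _ => ?_
  rw [history_castSucc]
  rfl

open Classical in
theorem visits_history_succ (P : Set (EuclideanSpace ℝ (Fin n))) (ω : ℕ → Bool) (k : ℕ) :
    visits P (k + 1) (history S₁ S₂ θ x₀ ω (k + 1)) = visits P k (history S₁ S₂ θ x₀ ω k) +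
      if position S₁ S₂ θ x₀ ω k ∈ P then 1 else 0 := by
  rw [visits_history, visits_history, Finset.sum_range_succ]

open Classical in
/-- The rule of selling the first `K` turns at which the token is in `P`. -/
noncomputable def SellingRule.first (P : Set (EuclideanSpace ℝ (Fin n))) (hP : P ⊆ D) (K : ℕ) :
    SellingRule D where
  sell k h := decide (h (Fin.last k) ∈ P ∧ visits P k h < K)
  sell_mem _ _ hs := hP (of_decide_eq_true hs).1

theorem SellingRule.first_sell_iff {P : Set (EuclideanSpace ℝ (Fin n))} {hP : P ⊆ D} {K k : ℕ}
    {h : Fin (k + 1) → EuclideanSpace ℝ (Fin n)} :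
    (SellingRule.first P hP K).sell k h = true ↔ h (Fin.last k) ∈ P ∧ visits P k h < K := by
  simp [SellingRule.first]

/-- Every visit to P is sold until K sales have been made, so fees can be read off from the visit
count, which both players' moves leave visible in the history. -/
theorem sold_first (P : Set (EuclideanSpace ℝ (Fin n))) (hP : P ⊆ D) (K : ℕ) (k : ℕ)
    (ω : ℕ → Bool) :
    sold S₁ S₂ (SellingRule.first P hP K) x₀ k ω =
      (min (visits P k (history S₁ S₂ (SellingRule.first P hP K) x₀ ω k)) K : ℕ) := by
  induction k with
  | zero => simp [sold, visits]
  | succ k ih =>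
    rw [sold_succ, ih, visits_history_succ]
    by_cases h1 : position S₁ S₂ (SellingRule.first P hP K) x₀ ω k ∈ P
    · by_cases h2 : visits P k (history S₁ S₂ (SellingRule.first P hP K) x₀ ω k) < K
      · rw [if_pos (SellingRule.first_sell_iff.2 ⟨h1, h2⟩), if_pos h1, min_eq_left h2.le,
          min_eq_left h2]
        push_cast
        ring
      · rw [if_neg (fun h => h2 (SellingRule.first_sell_iff.1 h).2), if_pos h1,
          min_eq_right (not_lt.1 h2), min_eq_right (by omega), add_zero]
    · rw [if_neg (fun h => h1 (SellingRule.first_sell_iff.1 h).1), if_neg h1, add_zero, add_zero]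

/-- The strategy of moving according to `f` until `P` has been visited `K` times and according to
`g` from then on. -/
noncomputable def Strategy.switch (P : Set (EuclideanSpace ℝ (Fin n))) (K : ℕ)
    (f g : ℕ → EuclideanSpace ℝ (Fin n) → EuclideanSpace ℝ (Fin n))
    (hf : ∀ k x, f k x ∈ Metric.closedBall x ε) (hg : ∀ k x, g k x ∈ Metric.closedBall x ε) :
    Strategy n ε where
  move k h := if visits P k h < K then f k (h (Fin.last k)) else g k (h (Fin.last k))
  move_mem k h := by
    split_ifs
    · exact hf k _
    · exact hg k _

end Game

section Game

variable {n : ℕ} {Ω D : Set (EuclideanSpace ℝ (Fin n))} {ε : ℝ}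
  {S₁ S₂ : Strategy n ε} {θ : SellingRule D} {x₀ : EuclideanSpace ℝ (Fin n)}

theorem visits_history_monotone (P : Set (EuclideanSpace ℝ (Fin n))) (ω : ℕ → Bool) :
    Monotone fun k => visits P k (history S₁ S₂ θ x₀ ω k) :=
  monotone_nat_of_le_succ fun k => by
    rw [visits_history_succ]
    exact Nat.le_add_right _ _

theorem visits_history_succ_flip (P : Set (EuclideanSpace ℝ (Fin n))) (ω : ℕ → Bool) (k : ℕ) :
    visits P (k + 1) (history S₁ S₂ θ x₀ (flip k ω) (k + 1)) =
      visits P (k + 1) (history S₁ S₂ θ x₀ ω (k + 1)) := by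
  rw [visits_history_succ, visits_history_succ, history_flip le_rfl, position_flip le_rfl]

/-- If Player II sells at most `K` turns, moves down along a bounded function `u` outside of `P`
before that and into a fixed direction afterwards, then the game ends. -/
theorem ae_ends_switch_first (hΩ : IsOpen Ω) (hΩb : Bornology.IsBounded Ω) (hε : 0 < ε)
    (hx₀ : x₀ ∈ Ω ∪ boundaryStrip Ω ε) (i : Fin n) {u : EuclideanSpace ℝ (Fin n) → ℝ} {M c : ℝ}
    (hM : ∀ x, |u x| ≤ M) (hc : 0 < c) {P : Set (EuclideanSpace ℝ (Fin n))} (hP : P ⊆ D)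
    (K : ℕ) {f g : ℕ → EuclideanSpace ℝ (Fin n) → EuclideanSpace ℝ (Fin n)}
    (hf : ∀ k x, f k x ∈ Metric.closedBall x ε) (hg : ∀ k x, g k x ∈ Metric.closedBall x ε)
    (hfu : ∀ k, ∀ x ∈ Ω, x ∉ P → u (f k x) ≤ u x - c) (hgi : ∀ k x, (g k x) i = x i - ε)
    (S₁ : Strategy n ε) :
    ∀ᵐ ω ∂coinMeasure, Ends Ω S₁ (Strategy.switch P K f g hf hg) (SellingRule.first P hP K) x₀ ω := by
  set S₂ := Strategy.switch P K f g hf hg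
  set θ := SellingRule.first P hP K
  filter_upwards [ae_exists_runs false] with ω hω
  by_contra hnot
  have hin k : position S₁ S₂ θ x₀ ω k ∈ Ω :=
    position_mem_of_not_hit hΩ hx₀ fun j _ hj => hnot ⟨j, hj⟩
  set N : ℕ → ℕ := fun k => visits P k (history S₁ S₂ θ x₀ ω k) with hN
  have hNmono : Monotone N := visits_history_monotone P ω
  -- Either the quota is used up, and runs of lost tosses carry the token out of the bounded set in
  -- direction i; or the visit count stabilizes below K, the token avoids P from then on, and such
  -- runs make u unbounded.
  by_cases h : ∃ m, K ≤ N m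
  · obtain ⟨m, hm⟩ := h
    obtain ⟨R, -, hR⟩ := hΩb.exists_pos_norm_le
    refine not_bounded_of_runs (m := m) (fun N m => hω N m)
      (a := fun k => position S₁ S₂ θ x₀ ω k i) hε (M := R)
      (fun k _ => (PiLp.norm_apply_le _ i).trans (hR _ (hin k))) fun k hk hk' => ?_
    have hle : ¬ N k < K := not_lt.2 (hm.trans (hNmono hk))
    have hs : θ.sell k (history S₁ S₂ θ x₀ ω k) = false :=
      Bool.eq_false_iff.2 fun h => hle (SellingRule.first_sell_iff.1 h).2
    have hmove : S₂.move k (history S₁ S₂ θ x₀ ω k) = g k (position S₁ S₂ θ x₀ ω k) := if_neg hle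
    simp only [position_succ_of_false hk' hs, hmove, hgi]
    exact le_rfl
  · push Not at h
    obtain ⟨m, hm⟩ := Nat.sSup_mem (Set.range_nonempty N)
      ⟨K, by rintro _ ⟨k, rfl⟩; exact (h k).le⟩
    have hmax k : N k ≤ N m := by
      rw [hm]
      exact le_csSup ⟨K, by rintro _ ⟨k, rfl⟩; exact (h k).le⟩ ⟨k, rfl⟩
    refine not_bounded_of_runs (m := m) (fun N m => hω N m)
      (a := fun k => u (position S₁ S₂ θ x₀ ω k)) hc (fun k _ => hM _) fun k hk hk' => ?_
    have hnP : position S₁ S₂ θ x₀ ω k ∉ P := by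
      intro hkP
      have h1 : N (k + 1) = N k + 1 := by
        simp only [hN]
        rw [visits_history_succ, if_pos hkP]
      have h2 := hmax (k + 1)
      have h3 := hNmono hk
      omega
    have hs : θ.sell k (history S₁ S₂ θ x₀ ω k) = false :=
      Bool.eq_false_iff.2 fun h => hnP (SellingRule.first_sell_iff.1 h).1
    have hmove : S₂.move k (history S₁ S₂ θ x₀ ω k) = f k (position S₁ S₂ θ x₀ ω k) := if_pos (h k)
    simp only [position_succ_of_false hk' hs, hmove]
    exact hfu k _ (hin k) hnP

/-- Player II guarantees a bounded solution, up to an error, by selling a bounded number of turns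
and otherwise moving to almost minimal points. -/
theorem exists_strategyII_guarantee (hn : 1 ≤ n) (hΩ : IsOpen Ω) (hΩb : Bornology.IsBounded Ω)
    (hε : 0 < ε) {F u : EuclideanSpace ℝ (Fin n) → ℝ} (hu : IsSolution Ω ε F u)
    {M : ℝ} (hM : ∀ x, |u x| ≤ M)
    {x₀ : EuclideanSpace ℝ (Fin n)} (hx₀ : x₀ ∈ Ω ∪ boundaryStrip Ω ε)
    {η l : ℝ} (hη : 0 < η) (hηε : η ≤ ε) (hl : 0 < l) (hl1 : l ≤ 1) :
    ∃ (S₂ : Strategy n ε) (θ : SellingRule Ω), ∀ S₁ : Strategy n ε,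
      expectedPayoffII Ω F S₁ S₂ θ x₀ ≤ (((1 - l) * u x₀ + l * M + η : ℝ) : EReal) := by
  have hM0 : 0 ≤ M := (abs_nonneg _).trans (hM x₀)
  -- After K sales the slack lεK exceeds 2M, the possible range of u.
  obtain ⟨K, hK⟩ := exists_nat_gt (2 * M / (l * ε))
  have hK0 : 0 < K := by
    have : (0 : ℝ) < K := lt_of_le_of_lt (by positivity) hK
    exact_mod_cast this
  rw [div_lt_iff₀ (by positivity)] at hK
  set e : ℕ → ℝ := fun k => η / 2 ^ k with he
  have hepos k : 0 < e k := by positivity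
  have heη k : e k ≤ η := div_le_self hη.le (one_le_pow₀ (by norm_num))
  have hestep k : e (k + 1) = e k / 2 := by simp only [he, pow_succ]; field_simp
  set i : Fin n := ⟨0, hn⟩
  set P : Set (EuclideanSpace ℝ (Fin n)) :=
    {x | x ∈ Ω ∧ ∀ y ∈ Metric.closedBall x ε, u y ≤ u x + ε} with hPdef
  have hP : P ⊆ Ω := fun x hx => hx.1
  have hdn : ∀ k x, ∃ z ∈ Metric.closedBall x ε, x ∈ Ω → x ∉ P → (u z + ε ≤ u x + e k / 2 ∧
      ∀ y ∈ Metric.closedBall x ε, u y + u z ≤ 2 * u x + e k / 2) := by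
    intro k x
    by_cases hx : x ∈ Ω ∧ x ∉ P
    · obtain ⟨y, hy, h⟩ := hu.exists_down x hx.1 (fun h => hx.2 ⟨hx.1, h⟩) (e k / 2)
        (half_pos (hepos k))
      exact ⟨y, hy, fun _ _ => h⟩
    · exact ⟨x, Metric.mem_closedBall_self hε.le, fun h h' => absurd ⟨h, h'⟩ hx⟩
  choose dn hdnmem hdn using hdn
  have hgmem : ∀ (_ : ℕ) x, x + EuclideanSpace.single i (-ε) ∈ Metric.closedBall x ε := by
    intro _ x
    simp [abs_of_pos hε]
  refine ⟨Strategy.switch P K dn (fun _ x => x + EuclideanSpace.single i (-ε)) hdnmem hgmem,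
    SellingRule.first P hP K, fun S₁ => ?_⟩
  have hend := ae_ends_switch_first hΩ hΩb hε hx₀ i hM (half_pos hε) hP K hdnmem hgmem
    (fun k x hx hxP => by linarith [(hdn k x hx hxP).1, heη k])
    (fun k x => by simp [sub_eq_add_neg]) S₁
  set S₂ := Strategy.switch P K dn (fun _ x => x + EuclideanSpace.single i (-ε)) hdnmem hgmem
  set θ := SellingRule.first P hP K with hθ
  set N : ℕ → (ℕ → Bool) → ℕ := fun k ω => visits P k (history S₁ S₂ θ x₀ ω k) with hN
  -- Once K visits have occurred, M - εK bounds every possible payoff, so the later play can be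
  -- ignored. The term lM makes the first branch dominate the payoff despite the factor 1 - l.
  set V : ℕ → (ℕ → Bool) → ℝ := fun k ω =>
    if N k ω < K then (1 - l) * (u (position S₁ S₂ θ x₀ ω k) - ε * N k ω) + l * M + e k
    else M - ε * K with hV
  have hFu k ω (h : position S₁ S₂ θ x₀ ω k ∈ boundaryStrip Ω ε) :
      F (position S₁ S₂ θ x₀ ω k) = u (position S₁ S₂ θ x₀ ω k) := (hu.boundary _ h).symm
  have hsold k ω : sold S₁ S₂ θ x₀ k ω = (min (N k ω) K : ℕ) := sold_first P hP K k ω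
  have hlM : 0 ≤ l * M := by positivity
  -- Entering the second phase never raises the potential: this is where the choice of K is used.
  have hphase {x : EuclideanSpace ℝ (Fin n)} {c : ℕ} (hc : c < K) :
      M - ε * K ≤ (1 - l) * (u x - ε * c) + l * M := by
    have h1 : ε * c ≤ ε * K := by gcongr
    have h2 : (1 - l) * (-M - ε * K) ≤ (1 - l) * (u x - ε * c) :=
      mul_le_mul_of_nonneg_left (by linarith [(abs_le.1 (hM x)).1]) (by linarith)
    have h3 : (1 - l) * (-M - ε * K) = -M - ε * K + l * M + K * (l * ε) := by ring
    linarith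
  have hVlow k ω : M - ε * K ≤ V k ω := by
    simp only [hV]
    split_ifs with h
    · linarith [hphase (x := position S₁ S₂ θ x₀ ω k) h, hepos k]
    · exact le_rfl
  have key := integrable_and_le_integral_at_hit
    (V := fun k ω => -V k ω)
    (P := fun k ω => -(F (position S₁ S₂ θ x₀ ω k) - ε * sold S₁ S₂ θ x₀ k ω))
    (hit := fun k ω => position S₁ S₂ θ x₀ ω k ∈ boundaryStrip Ω ε) (B := M + ε * K)
    (y := -((1 - l) * u x₀ + l * M + η))
    (fun k ω ω' h => ?_) (fun k ω ω' h => congrArg (- ·) (dependsOn_payoff F k h))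
    dependsOn_hit
    (fun k ω => ?_) (fun k ω h => ?_) (fun k ω h => ?_) (fun k ω h => ?_) (fun ω => ?_) hend
  · rw [expectedPayoffII, if_pos hend]
    have e1 : (payoff Ω F S₁ S₂ θ x₀) = fun ω =>
        F (position S₁ S₂ θ x₀ ω (sInf {k | position S₁ S₂ θ x₀ ω k ∈ boundaryStrip Ω ε})) -
          ε * sold S₁ S₂ θ x₀ (sInf {k | position S₁ S₂ θ x₀ ω k ∈ boundaryStrip Ω ε}) ω := rfl
    have hint : Integrable (payoff Ω F S₁ S₂ θ x₀) coinMeasure := by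
      rw [← integrable_neg_iff]
      exact key.1
    rw [expectation_eq_integral hint]
    refine EReal.coe_le_coe ?_
    have h2 := key.2
    rw [integral_neg] at h2
    rw [e1]
    linarith
  · have hNω : N k ω = N k ω' := by
      simp only [hN, history_congr S₁ S₂ θ x₀ k h]
    simp only [hV, hNω, position_congr (S₁ := S₁) (S₂ := S₂) (θ := θ) (x₀ := x₀) le_rfl h]
  · linarith [hVlow k ω]
  · simp only [hFu k ω h, hsold]
    have h1 : ((min (N k ω) K : ℕ) : ℝ) ≤ K := by exact_mod_cast min_le_right _ _
    have h2 := mul_le_mul_of_nonneg_left h1 hε.le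
    linarith [(abs_le.1 (hM (position S₁ S₂ θ x₀ ω k))).1]
  · simp only [hFu k ω h, hsold, hV]
    have h1 := (abs_le.1 (hM (position S₁ S₂ θ x₀ ω k))).2
    split_ifs with hc
    · rw [min_eq_left hc.le]
      have h2 : 0 ≤ l * (ε * N k ω) := by positivity
      have h3 := mul_le_mul_of_nonneg_left h1 hl.le
      have h4 : (1 - l) * (u (position S₁ S₂ θ x₀ ω k) - ε * N k ω) =
        u (position S₁ S₂ θ x₀ ω k) - ε * N k ω - l * u (position S₁ S₂ θ x₀ ω k)
          + l * (ε * N k ω) := by ring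
      linarith [hepos k]
    · rw [min_eq_right (not_lt.1 hc)]
      linarith
  · have hx := position_mem_of_not_hit hΩ hx₀ h
    have hNflip : N (k + 1) (flip k ω) = N (k + 1) ω := visits_history_succ_flip P ω k
    have hm1 : S₁.move k (history S₁ S₂ θ x₀ ω k) ∈
      Metric.closedBall (position S₁ S₂ θ x₀ ω k) ε := S₁.move_mem k _
    by_cases hc : N k ω < K
    · have hVk : V k ω = (1 - l) * (u (position S₁ S₂ θ x₀ ω k) - ε * N k ω) + l * M + e k :=
        if_pos hc
      by_cases hxP : position S₁ S₂ θ x₀ ω k ∈ P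
      · have hs : θ.sell k (history S₁ S₂ θ x₀ ω k) = true :=
          SellingRule.first_sell_iff.2 ⟨hxP, hc⟩
        have hNk : N (k + 1) ω = N k ω + 1 := by
          simp only [hN]
          rw [visits_history_succ, if_pos hxP]
        -- On P a move by Player I raises u by at most ε, and the fee for the sold turn compensates
        -- for this.
        have hle : ∀ ω', N (k + 1) ω' = N k ω + 1 →
            u (position S₁ S₂ θ x₀ ω' (k + 1)) ≤ u (position S₁ S₂ θ x₀ ω k) + ε →
            V (k + 1) ω' ≤ V k ω := by
          intro ω' h1 h2
          rw [hVk]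
          simp only [hV, h1, hestep]
          split_ifs
          · push_cast
            have : (1 - l) * (u (position S₁ S₂ θ x₀ ω' (k + 1)) - ε * (N k ω + 1)) ≤
                (1 - l) * (u (position S₁ S₂ θ x₀ ω k) - ε * N k ω) :=
              mul_le_mul_of_nonneg_left (by linarith) (by linarith)
            linarith [hepos k]
          -- This was the K-th sale: the potential drops to the constant of the second phase.
          · linarith [hphase (x := position S₁ S₂ θ x₀ ω k) hc, hepos k]
        have hy := hxP.2 _ hm1
        rcases position_succ_cases (S₁ := S₁) (S₂ := S₂) (θ := θ) (x₀ := x₀) ω k with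
          ⟨-, h1, h2⟩ | ⟨h1, -⟩
        · linarith [hle ω hNk (by rw [h1]; exact hy),
            hle (flip k ω) (hNflip.trans hNk) (by rw [h2]; exact hy)]
        · rw [hs] at h1
          exact absurd h1 (by simp)
      · have hs : ¬ θ.sell k (history S₁ S₂ θ x₀ ω k) = true := fun h =>
          hxP (SellingRule.first_sell_iff.1 h).1
        have hNk : N (k + 1) ω = N k ω := by
          simp only [hN]
          rw [visits_history_succ, if_neg hxP, add_zero]
        have hVeq : ∀ ω', N (k + 1) ω' = N k ω → V (k + 1) ω' =
            (1 - l) * (u (position S₁ S₂ θ x₀ ω' (k + 1)) - ε * N k ω) + l * M + e k / 2 := by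
          intro ω' h1
          simp only [hV, h1, hestep, hc, if_true]
        have hmove : S₂.move k (history S₁ S₂ θ x₀ ω k) = dn k (position S₁ S₂ θ x₀ ω k) :=
          if_pos hc
        have hsum : u (position S₁ S₂ θ x₀ ω (k + 1)) +
            u (position S₁ S₂ θ x₀ (flip k ω) (k + 1)) ≤
            2 * u (position S₁ S₂ θ x₀ ω k) + e k / 2 := by
          have h0 := (hdn k _ hx hxP).2 _ hm1
          rcases position_succ_cases (S₁ := S₁) (S₂ := S₂) (θ := θ) (x₀ := x₀) ω k with
            ⟨h1, -⟩ | ⟨-, ⟨h1, h2⟩ | ⟨h1, h2⟩⟩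
          · exact absurd h1 hs
          · rw [h1, h2, hmove]
            exact h0
          · rw [h1, h2, hmove]
            linarith
        rw [hVk, hVeq ω hNk, hVeq _ (hNflip.trans hNk)]
        have h3 := mul_le_mul_of_nonneg_left hsum (show 0 ≤ 1 - l by linarith)
        have h4 : 0 ≤ l * e k := mul_nonneg hl.le (hepos k).le
        linarith [hepos k]
    · have hc' : ¬ N (k + 1) ω < K := fun h =>
        hc (lt_of_le_of_lt (visits_history_monotone P ω (Nat.le_succ k)) h)
      have h1 : V k ω = M - ε * K := if_neg hc
      have h2 : V (k + 1) ω = M - ε * K := if_neg hc'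
      have h3 : V (k + 1) (flip k ω) = M - ε * K := if_neg (hNflip ▸ hc')
      rw [h1, h2, h3]
      linarith
  · have hN0 : N 0 ω = 0 := by simp [hN, visits]
    have hp0 : position S₁ S₂ θ x₀ ω 0 = x₀ := rfl
    simp only [hV, hN0, hK0, if_true, hp0, he]
    simp

/-! ### Comparison of the two values -/

/-- Weak duality; the conventions -∞ and +∞ for unfinished games point in the favourable directions.
-/
theorem valueI_le_valueII (F : EuclideanSpace ℝ (Fin n) → ℝ) (x₀ : EuclideanSpace ℝ (Fin n)) :
    valueI Ω D ε F x₀ ≤ valueII Ω D ε F x₀ := by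
  refine iSup_le fun S₁ => le_iInf fun S₂ => le_iInf fun θ => ?_
  refine (iInf_le_of_le S₂ (iInf_le _ θ)).trans (le_trans ?_ (le_iSup _ S₁))
  unfold expectedPayoffI expectedPayoffII
  split_ifs
  · exact le_rfl
  · exact bot_le

theorem le_valueI_of_isSolution (hΩ : IsOpen Ω) (hε : 0 < ε)
    {F u : EuclideanSpace ℝ (Fin n) → ℝ} (hu : IsSolution Ω ε F u)
    (hx₀ : x₀ ∈ Ω ∪ boundaryStrip Ω ε) : (u x₀ : EReal) ≤ valueI Ω D ε F x₀ := by
  refine EReal.ge_of_forall_gt_iff_ge.1 fun z hz => ?_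
  have hz' : z < u x₀ := EReal.coe_lt_coe_iff.1 hz
  obtain ⟨S₁, h⟩ := exists_strategyI_guarantee (D := D) hΩ hε hu hx₀
    (lt_min (sub_pos.2 hz') hε) (min_le_right _ _)
  refine le_trans (EReal.coe_le_coe ?_) (le_iSup_of_le S₁ (le_iInf fun S₂ => le_iInf (h S₂)))
  linarith [min_le_left (u x₀ - z) ε]

theorem valueII_le_of_isSolution (hn : 1 ≤ n) (hΩ : IsOpen Ω) (hΩb : Bornology.IsBounded Ω)
    (hε : 0 < ε) {F u : EuclideanSpace ℝ (Fin n) → ℝ} (hu : IsSolution Ω ε F u)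
    (hx₀ : x₀ ∈ Ω ∪ boundaryStrip Ω ε) : valueII Ω Ω ε F x₀ ≤ (u x₀ : EReal) := by
  refine EReal.le_of_forall_lt_iff_le.1 fun z hz => ?_
  have hz' : u x₀ < z := EReal.coe_lt_coe_iff.1 hz
  obtain ⟨M, hM0, hM⟩ := hu.bounded
  set d := z - u x₀ with hd
  have hd0 : 0 < d := sub_pos.2 hz'
  -- The discount costs l(M - u x₀) ≤ 2lM, which gets half of the gap d; the other half is left for
  -- η.
  obtain ⟨l, hl, hl1, hle⟩ : ∃ l : ℝ, 0 < l ∧ l ≤ 1 ∧ l * (2 * M) ≤ d / 2 := by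
    refine ⟨min 1 (d / 2 / (2 * M + 1)), lt_min one_pos (by positivity), min_le_left _ _, ?_⟩
    calc min 1 (d / 2 / (2 * M + 1)) * (2 * M) ≤ d / 2 / (2 * M + 1) * (2 * M + 1) := by
          gcongr
          · exact min_le_right _ _
          · linarith
      _ = d / 2 := by field_simp
  obtain ⟨S₂, θ, h⟩ := exists_strategyII_guarantee hn hΩ hΩb hε hu hM hx₀
    (lt_min (half_pos hd0) hε) (min_le_right _ _) hl hl1
  refine (iInf_le_of_le S₂ (iInf_le_of_le θ (iSup_le h))).trans (EReal.coe_le_coe ?_)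
  have h1 := mul_le_mul_of_nonneg_left (abs_le.1 (hM x₀)).1 hl.le
  have h2 := min_le_left (d / 2) ε
  linarith

end Game

end TugOfWar

theorem theorem5p6 (n : ℕ) (hn : 1 ≤ n) (Ω : Set (EuclideanSpace ℝ (Fin n)))
    (hΩ_open : IsOpen Ω) (hΩ_bdd : Bornology.IsBounded Ω) (ε : ℝ) (hε : 0 < ε)
    (F : EuclideanSpace ℝ (Fin n) → ℝ)
    (hF_cont : ContinuousOn F (TugOfWar.boundaryStrip Ω ε))
    (hF_bdd : ∃ C : ℝ, ∀ x ∈ TugOfWar.boundaryStrip Ω ε, |F x| ≤ C) :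
    ∀ x ∈ Ω ∪ TugOfWar.boundaryStrip Ω ε,
      TugOfWar.omegaGameValueI Ω ε F x = TugOfWar.omegaGameValueII Ω ε F x := by
  intro x hx
  obtain ⟨u, hu⟩ := TugOfWar.exists_isSolution hn hΩ_bdd hε hF_bdd
  exact le_antisymm (TugOfWar.valueI_le_valueII F x)
    ((TugOfWar.valueII_le_of_isSolution hn hΩ_open hΩ_bdd hε hu hx).trans
      (TugOfWar.le_valueI_of_isSolution hΩ_open hε hu hx))
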